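/- Let $n\ge 2$. Let $\mathbb M^n$ be the Euclidean space $\mathbb R^n$, the hyperbolic space $\mathbb H^n$ (curvature $-1$) or the unit sphere $\mathbb S^n$, with geodesic distance $d$, and let $\mathbb M^n_+$ be $\mathbb R^n$, $\mathbb H^n$ or the open hemisphere $\mathbb S^n_+$ respectively. $|\cdot|_g$ denotes Riemannian volume or area, and $B_r(p)$ is the open ball of radius $r$ about $p$ in $(\mathbb M^n,d)$. **Deficit functions.** Let $\Upsilon$ be the class of relatively compact connected open sets $\Omega\subset\mathbb M^n_+$ (with closure in $\mathbb M^n_+$) whose boundary is a connected closed $C^2$-regular embedded hypersurface, with the topology of the Hausdorff distance. A *deficit function* is a continuous function $\mathrm{def}:\Upsilon\to[0,\infty)$ such that $\mathrm{def}(\Omega)=0$ if and only if $\Omega$ is a ball. **Moving planes.** Fix the base point $\mathfrak o\in\mathbb M^n_+$ (the north pole in the case of the hemisphere). For a unit vector $v\in T_{\mathfrak o}\mathbb M^n$ let $\gamma_v:I\to\mathbb M^n_+$ be the geodesic with $\gamma_v(0)=\mathfrak o$, $\dot\gamma_v(0)=v$, where $I=\mathbb R$, or $I=(-\frac\pi2,\frac\pi2)$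 for the hemisphere. For $s\in I$ let $\pi_{v,s}$ be the totally geodesic hyperplane through $\gamma_v(s)$ orthogonal to $\dot\gamma_v(s)$. For $\Omega\in\Upsilon$ with $S=\partial\Omega$ put $S_{v,s}=\{p\in S: p\in\pi_{v,t}\text{ for some }t\in I,\ t>s\}$, let $S^\pi_{v,s}$ be its reflection about $\pi_{v,s}$, and let $$m_v=\inf\{s\in I:\ S^\pi_{v,t}\subset\Omega\text{ for every }t\in I,\ t>s\}.$$ The critical hyperplane is $\pi_v=\pi_{v,m_v}$ and the maximal cap in the direction $v$ is $\Omega_v=\{p\in\Omega: p\in\pi_{v,t}\text{ for some }t\in I,\ t>m_v\}$. **Approximate symmetry property.** $\Omega$ satisfies (ASP) with constant $\mathcal K>0$ if for every direction $v$ there is a connected component $\Sigma$ of $\Omega_v$ such that $d(p,\Sigma\cup\Sigma^{\pi_v})\le\mathcal K\,\mathrm{def}(\Omega)$ for every $p\in\Omega$, where $\Sigma^{\pi_v}$ is the reflection of $\Sigma$ about $\pi_v$. **Touching balls.** $S=\partial\Omega$ satisfies the uniform touching ball condition of radius $\rho>0$ if every $p\in S$ lies on the boundary of a ball of radius $\rho$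 contained in $\Omega$ and on the boundary of a ball of radius $\rho$ of $\mathbb M^n$ disjoint from $\Omega$. **Theorem 6.3.** For all $\rho,A,\mathcal K>0$ there is a constant $C>0$, depending only on $n,\rho,A,\mathcal K$, with the following property. Let $\mathrm{def}$ be a deficit function and let $\Omega\in\Upsilon$ have boundary $S$ of area $|S|_g\le A$ satisfying the uniform touching ball condition of radius $\rho$. Suppose that $\Omega$ satisfies (ASP) with constant $\mathcal K$ and that $$\mathrm{def}(\Omega)\le\frac{|\Omega|_g}{4\mathcal K}.$$ Then there are a point $\mathcal O\in\mathbb M^n_+$ and radii $0<r\le R$ with $$B_r(\mathcal O)\subseteq\Omega\subseteq B_R(\mathcal O)\qquad\text{and}\qquad R-r\le C\,\mathrm{def}(\Omega).$$ -/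

import Mathlib

open scoped Topology MeasureTheory

noncomputable section

/-- The three kinds of space forms: `ℝⁿ`, hyperbolic space `ℍⁿ`, the unit sphere `𝕊ⁿ`. -/
inductive SpaceForm : Type
  | euclidean
  | hyperbolic
  | spherical

namespace SpaceForm

/-- The linear space `ℝ × ℝⁿ` in which the three `n`-dimensional space forms are realised. -/
abbrev Ambient (n : ℕ) : Type := WithLp 2 (ℝ × EuclideanSpace ℝ (Fin n))

/-- The symmetric bilinear form on `ℝ × ℝⁿ` whose restriction to the tangent spaces is the
Riemannian metric: `⟨x', y'⟩` (Euclidean), `⟨x', y'⟩ - x₀ y₀` (hyperbolic, the Lorentz form),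
`⟨x', y'⟩ + x₀ y₀` (spherical). -/
def form {n : ℕ} : SpaceForm → Ambient n → Ambient n → ℝ
  | euclidean, x, y => inner ℝ x.snd y.snd
  | hyperbolic, x, y => inner ℝ x.snd y.snd - x.fst * y.fst
  | spherical, x, y => inner ℝ x.snd y.snd + x.fst * y.fst

/-- The space forms as subsets of `ℝ × ℝⁿ`: the affine hyperplane `{1} × ℝⁿ`, the upper sheet of
the hyperboloid `⟨x, x⟩ = -1` (hyperboloid model of `ℍⁿ`), and the unit sphere. -/
def carrier {n : ℕ} : SpaceForm → Set (Ambient n)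
  | euclidean => {x | x.fst = 1}
  | hyperbolic => {x | form hyperbolic x x = -1 ∧ 0 < x.fst}
  | spherical => {x | form spherical x x = 1}

/-- The tangent space at the point `p`, as a set of vectors of `ℝ × ℝⁿ`. -/
def tangent {n : ℕ} : SpaceForm → Ambient n → Set (Ambient n)
  | euclidean, _ => {w | w.fst = 0}
  | hyperbolic, p => {w | form hyperbolic p w = 0}
  | spherical, p => {w | form spherical p w = 0}

/-- The geodesic distance: `|x - y|`, `arcosh (-⟨x, y⟩)`, `arccos ⟨x, y⟩`. -/
def geoDist {n : ℕ} : SpaceForm → Ambient n → Ambient n → ℝ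
  | euclidean, x, y => ‖x.snd - y.snd‖
  | hyperbolic, x, y => Real.arcosh (-form hyperbolic x y)
  | spherical, x, y => Real.arccos (form spherical x y)

/-- The type of points of the `n`-dimensional space form `𝕄ⁿ` of kind `M`. -/
@[ext] structure Point (M : SpaceForm) (n : ℕ) where
  val : Ambient n
  mem : val ∈ carrier M

variable {n : ℕ}

lemma ambient_ext {x y : Ambient n} (h1 : x.fst = y.fst) (h2 : x.snd = y.snd) : x = y :=
  WithLp.ofLp_injective 2 (Prod.ext h1 h2)

lemma form_comm (M : SpaceForm) (x y : Ambient n) : form M x y = form M y x := by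
  cases M <;> simp only [form, real_inner_comm, mul_comm]

lemma form_sub_left (M : SpaceForm) (x y z : Ambient n) :
    form M (x - y) z = form M x z - form M y z := by
  cases M <;> simp only [form, WithLp.sub_fst, WithLp.sub_snd, inner_sub_left] <;> ring

lemma form_add_left (M : SpaceForm) (x y z : Ambient n) :
    form M (x + y) z = form M x z + form M y z := by
  cases M <;> simp only [form, WithLp.add_fst, WithLp.add_snd, inner_add_left] <;> ring

lemma form_smul_left (M : SpaceForm) (c : ℝ) (x z : Ambient n) :
    form M (c • x) z = c * form M x z := by
  cases M <;> simp only [form, WithLp.smul_fst, WithLp.smul_snd, real_inner_smul_left,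
    smul_eq_mul] <;> ring

lemma form_sub_right (M : SpaceForm) (x y z : Ambient n) :
    form M x (y - z) = form M x y - form M x z := by
  rw [form_comm, form_sub_left, form_comm M y, form_comm M z]

lemma form_add_right (M : SpaceForm) (x y z : Ambient n) :
    form M x (y + z) = form M x y + form M x z := by
  rw [form_comm, form_add_left, form_comm M y, form_comm M z]

lemma form_smul_right (M : SpaceForm) (c : ℝ) (x z : Ambient n) :
    form M x (c • z) = c * form M x z := by
  rw [form_comm, form_smul_left, form_comm M z]

lemma lorentz_ge (y w : Ambient n) (hy : form hyperbolic y y = -1)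
    (hw : form hyperbolic y w = 0) : ‖w.snd‖ ^ 2 ≤ y.fst ^ 2 * form hyperbolic w w := by
  simp only [form, real_inner_self_eq_norm_sq] at *
  have h := abs_real_inner_le_norm y.snd w.snd
  have h2 : (inner ℝ y.snd w.snd) ^ 2 ≤ (‖y.snd‖ * ‖w.snd‖) ^ 2 := sq_le_sq' (by
    linarith [neg_abs_le (inner ℝ y.snd w.snd)]) (by linarith [le_abs_self (inner ℝ y.snd w.snd)])
  have h3 : inner ℝ y.snd w.snd = y.fst * w.fst := by linarith
  rw [h3] at h2
  have h4 : ‖y.snd‖ ^ 2 = y.fst ^ 2 - 1 := by nlinarith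
  have h5 : (‖y.snd‖ * ‖w.snd‖) ^ 2 = (y.fst ^ 2 - 1) * ‖w.snd‖ ^ 2 := by rw [mul_pow, h4]
  nlinarith

lemma lorentz_nonneg (y w : Ambient n) (hy : form hyperbolic y y = -1)
    (hw : form hyperbolic y w = 0) : 0 ≤ form hyperbolic w w := by
  have h := lorentz_ge y w hy hw
  have hy' : 1 ≤ y.fst ^ 2 := by
    simp only [form, real_inner_self_eq_norm_sq] at hy
    nlinarith [sq_nonneg ‖y.snd‖]
  by_contra hc
  push Not at hc
  nlinarith [sq_nonneg ‖w.snd‖]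

lemma lorentz_pos (x y : Ambient n) (hx : x ∈ carrier hyperbolic) (hy : y ∈ carrier hyperbolic) :
    0 < -form hyperbolic x y := by
  obtain ⟨hx, hx0⟩ := hx
  obtain ⟨hy, hy0⟩ := hy
  simp only [form, real_inner_self_eq_norm_sq] at *
  have h := real_inner_le_norm x.snd y.snd
  have h1 : ‖x.snd‖ < x.fst := abs_lt_of_sq_lt_sq' (by nlinarith) hx0.le |>.2
  have h2 : ‖y.snd‖ < y.fst := abs_lt_of_sq_lt_sq' (by nlinarith) hy0.le |>.2
  nlinarith [norm_nonneg x.snd, norm_nonneg y.snd]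

lemma lorentz_proj (x y z : Ambient n) (hx : x ∈ carrier hyperbolic)
    (hy : y ∈ carrier hyperbolic) (hz : z ∈ carrier hyperbolic) :
    (form hyperbolic x z + form hyperbolic x y * form hyperbolic y z) ^ 2 ≤
      (form hyperbolic x y ^ 2 - 1) * (form hyperbolic y z ^ 2 - 1) := by
  have hxx := hx.1
  have hyy := hy.1
  have hzz := hz.1
  have key : ∀ t : ℝ, 0 ≤ (form hyperbolic y z ^ 2 - 1) * (t * t) +
      (2 * (form hyperbolic x z + form hyperbolic x y * form hyperbolic y z)) * t +
      (form hyperbolic x y ^ 2 - 1) := by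
    intro t
    have h := lorentz_nonneg y
      ((x + form hyperbolic x y • y) + t • (z + form hyperbolic y z • y)) hyy (by
        simp only [form_add_right, form_smul_right, hyy, form_comm hyperbolic y x]; ring)
    simp only [form_add_right, form_smul_right, form_add_left, form_smul_left, hxx, hyy, hzz,
      form_comm hyperbolic y x, form_comm hyperbolic z x, form_comm hyperbolic z y] at h
    nlinarith
  have := discrim_le_zero key
  simp only [discrim] at this
  nlinarith

lemma one_le_lorentz (x y : Ambient n) (hx : x ∈ carrier hyperbolic)
    (hy : y ∈ carrier hyperbolic) : 1 ≤ -form hyperbolic x y := by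
  have h := lorentz_nonneg y (x + form hyperbolic x y • y) hy.1 (by
    simp only [form_add_right, form_smul_right, hy.1, form_comm hyperbolic y x]; ring)
  simp only [form_add_right, form_smul_right, form_add_left, form_smul_left, hx.1, hy.1,
    form_comm hyperbolic y x] at h
  nlinarith [lorentz_pos x y hx hy]

lemma eq_of_lorentz (x y : Ambient n) (hx : x ∈ carrier hyperbolic)
    (hy : y ∈ carrier hyperbolic) (h : -form hyperbolic x y = 1) : x = y := by
  have hxy : form hyperbolic x y = -1 := by linarith
  have h0 : form hyperbolic y (x - y) = 0 := by
    rw [form_sub_right, hy.1, form_comm, hxy]; ring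
  have h1 : form hyperbolic (x - y) (x - y) = 0 := by
    rw [form_sub_left, h0, form_sub_right, hx.1, hxy]; ring
  have h2 := lorentz_ge y (x - y) hy.1 h0
  rw [h1, mul_zero] at h2
  have h3 : (x - y).snd = 0 := by
    rw [← norm_eq_zero]; nlinarith [norm_nonneg (x - y).snd]
  have h4 : (x - y).fst = 0 := by
    simp only [form, h3, inner_zero_left] at h1
    nlinarith
  exact ambient_ext (by simpa [sub_eq_zero] using h4) (by simpa [sub_eq_zero] using h3)

lemma form_spherical (x y : Ambient n) : form spherical x y = inner ℝ x y := by
  simp only [form, WithLp.prod_inner_apply]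
  simp [mul_comm, add_comm]

lemma norm_of_spherical (x : Ambient n) (hx : x ∈ carrier spherical) : ‖x‖ = 1 := by
  have h : form spherical x x = 1 := hx
  rw [form_spherical, real_inner_self_eq_norm_sq] at h
  nlinarith [norm_nonneg x]

lemma geoDist_spherical (x y : Ambient n) (hx : x ∈ carrier spherical)
    (hy : y ∈ carrier spherical) : geoDist spherical x y = InnerProductGeometry.angle x y := by
  simp [geoDist, InnerProductGeometry.angle, form_spherical, norm_of_spherical x hx,
    norm_of_spherical y hy]

lemma geoDist_triangle (M : SpaceForm) (x y z : Ambient n) (hx : x ∈ carrier M)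
    (hy : y ∈ carrier M) (hz : z ∈ carrier M) :
    geoDist M x z ≤ geoDist M x y + geoDist M y z := by
  cases M with
  | euclidean => exact norm_sub_le_norm_sub_add_norm_sub _ _ _
  | spherical =>
    rw [geoDist_spherical x z hx hz, geoDist_spherical x y hx hy, geoDist_spherical y z hy hz]
    exact InnerProductGeometry.angle_le_angle_add_angle x y z
  | hyperbolic =>
    have ha := one_le_lorentz x y hx hy
    have hb := one_le_lorentz y z hy hz
    have hc := one_le_lorentz x z hx hz
    have hp := lorentz_proj x y z hx hy hz
    simp only [geoDist]
    generalize form hyperbolic x y = a at *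
    generalize form hyperbolic y z = b at *
    generalize form hyperbolic x z = c at *
    have hn : 0 ≤ Real.arcosh (-a) + Real.arcosh (-b) :=
      add_nonneg (Real.arcosh_nonneg ha) (Real.arcosh_nonneg hb)
    rw [← Real.arcosh_cosh hn, Real.arcosh_le_arcosh (by linarith) (Real.cosh_pos _),
      Real.cosh_add, Real.cosh_arcosh ha, Real.cosh_arcosh hb, Real.sinh_arcosh ha,
      Real.sinh_arcosh hb, ← Real.sqrt_mul (by nlinarith)]
    have := Real.le_sqrt_of_sq_le (x := -(c + a * b)) (y := ((-a) ^ 2 - 1) * ((-b) ^ 2 - 1))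
      (by nlinarith)
    linarith

/-- `𝕄ⁿ` with its geodesic distance. -/
instance (M : SpaceForm) : MetricSpace (Point M n) where
  dist p q := geoDist M p.val q.val
  dist_self p := by
    obtain ⟨x, hx⟩ := p
    cases M with
    | euclidean => simp [geoDist]
    | hyperbolic =>
      have h : form hyperbolic x x = -1 := hx.1
      simp [geoDist, h]
    | spherical =>
      have h : form spherical x x = 1 := hx
      simp [geoDist, h]
  dist_comm p q := by
    cases M <;> simp only [geoDist]
    · exact norm_sub_rev _ _
    · rw [form_comm]
    · rw [form_comm]
  dist_triangle p q r := geoDist_triangle M _ _ _ p.mem q.mem r.mem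
  eq_of_dist_eq_zero := by
    intro p q h
    obtain ⟨x, hx⟩ := p
    obtain ⟨y, hy⟩ := q
    ext1
    change geoDist M x y = 0 at h
    change x = y
    cases M with
    | euclidean =>
      have h1 : x.snd = y.snd := sub_eq_zero.1 (norm_eq_zero.1 h)
      have h2 : x.fst = y.fst := Eq.trans (b := (1 : ℝ)) hx (Eq.symm hy)
      exact ambient_ext h2 h1
    | hyperbolic =>
      exact eq_of_lorentz x y hx hy ((Real.arcosh_eq_zero_iff (one_le_lorentz x y hx hy)).1 h)
    | spherical =>
      rw [geoDist_spherical x y hx hy] at h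
      have hc := congrArg Real.cos h
      rw [InnerProductGeometry.cos_angle, norm_of_spherical x hx, norm_of_spherical y hy,
        Real.cos_zero, mul_one, div_one] at hc
      exact (inner_eq_one_iff_of_norm_eq_one (𝕜 := ℝ) (norm_of_spherical x hx)
        (norm_of_spherical y hy)).1 hc

instance (M : SpaceForm) : MeasurableSpace (Point M n) := borel _

instance (M : SpaceForm) : BorelSpace (Point M n) := ⟨rfl⟩

/-- `𝕄ⁿ₊`: the whole space in the Euclidean and hyperbolic cases (where `x₀ > 0` holds at every
point), the open hemisphere around the north pole `(1, 0)` in the spherical case. -/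
def plus (M : SpaceForm) (n : ℕ) : Set (Point M n) := {p | 0 < p.val.fst}

/-! ### Moving planes

The base point is `(1, 0)`; its tangent space is `{0} × ℝⁿ`. -/

/-- Unit tangent vectors at the base point. -/
abbrev Direction (n : ℕ) : Type := Metric.sphere (0 : EuclideanSpace ℝ (Fin n)) 1

/-- The domain of the geodesics through the base point inside `𝕄ⁿ₊`. -/
def interval : SpaceForm → Set ℝ
  | euclidean => Set.univ
  | hyperbolic => Set.univ
  | spherical => Set.Ioo (-(Real.pi / 2)) (Real.pi / 2)

/-- The unit speed geodesic `γ_v` with `γ_v(0) = (1, 0)` and `γ_v'(0) = (0, v)`. -/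
def geodesic : SpaceForm → Direction n → ℝ → Ambient n
  | euclidean, v, s => WithLp.toLp 2 (1, s • v.1)
  | hyperbolic, v, s => WithLp.toLp 2 (Real.cosh s, Real.sinh s • v.1)
  | spherical, v, s => WithLp.toLp 2 (Real.cos s, Real.sin s • v.1)

/-- The velocity `γ_v'(s)`. -/
def velocity : SpaceForm → Direction n → ℝ → Ambient n
  | euclidean, v, _ => WithLp.toLp 2 (0, v.1)
  | hyperbolic, v, s => WithLp.toLp 2 (Real.sinh s, Real.cosh s • v.1)
  | spherical, v, s => WithLp.toLp 2 (-Real.sin s, Real.cos s • v.1)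

/-- The (totally geodesic) hyperplane `π_{v,s}` through `γ_v(s)` orthogonal to `γ_v'(s)`. -/
def hyperplane (M : SpaceForm) (v : Direction n) (s : ℝ) : Set (Point M n) :=
  {p | form M (p.val - geodesic M v s) (velocity M v s) = 0}

lemma form_velocity (M : SpaceForm) (v : Direction n) (s : ℝ) :
    form M (velocity M v s) (velocity M v s) = 1 := by
  have hv : ‖v.1‖ = 1 := norm_eq_of_mem_sphere v
  have h1 := Real.cosh_sq s
  have h2 := Real.sin_sq_add_cos_sq s
  cases M <;> simp [form, velocity, norm_smul, hv] <;> nlinarith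

lemma form_geodesic_velocity (M : SpaceForm) (v : Direction n) (s : ℝ) (hM : M ≠ euclidean) :
    form M (geodesic M v s) (velocity M v s) = 0 := by
  have hv : ‖v.1‖ = 1 := norm_eq_of_mem_sphere v
  cases M
  · exact absurd rfl hM
  all_goals
    simp [form, geodesic, velocity, real_inner_smul_left, real_inner_smul_right, hv, mul_comm]

lemma reflect_mem (M : SpaceForm) (v : Direction n) (s : ℝ) (p : Ambient n) (hp : p ∈ carrier M) :
    p - (2 * form M (p - geodesic M v s) (velocity M v s)) • velocity M v s ∈ carrier M := by
  have hN := form_velocity M v s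
  cases M with
  | euclidean =>
    have : p.fst = 1 := hp
    simp [carrier, velocity, this]
  | spherical =>
    have h0 := form_geodesic_velocity spherical v s (by simp)
    have hp' : form spherical p p = 1 := hp
    rw [form_sub_left, h0, sub_zero]
    change form spherical _ _ = 1
    simp only [form_sub_left, form_sub_right, form_smul_left, form_smul_right, hN, hp',
      form_comm spherical (velocity spherical v s) p]
    ring
  | hyperbolic =>
    have h0 := form_geodesic_velocity hyperbolic v s (by simp)
    rw [form_sub_left, h0, sub_zero]
    have hp1 : form hyperbolic p p = -1 := hp.1
    set q := p - (2 * form hyperbolic p (velocity hyperbolic v s)) • velocity hyperbolic v s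
      with hq
    have hq1 : form hyperbolic q q = -1 := by
      simp only [hq, form_sub_left, form_sub_right, form_smul_left, form_smul_right, hN, hp1,
        form_comm hyperbolic (velocity hyperbolic v s) p]
      ring
    have hpq : form hyperbolic p q < 0 := by
      simp only [hq, form_sub_right, form_smul_right, hp1]
      nlinarith [sq_nonneg (form hyperbolic p (velocity hyperbolic v s))]
    refine ⟨hq1, ?_⟩
    have hp0 := hp.2
    by_contra hc
    push Not at hc
    simp only [form, real_inner_self_eq_norm_sq] at hq1 hpq hp1
    have h1 : ‖p.snd‖ < p.fst := abs_lt_of_sq_lt_sq' (by nlinarith) hp0.le |>.2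
    have h2 : ‖q.snd‖ < -q.fst := abs_lt_of_sq_lt_sq' (by nlinarith) (by linarith) |>.2
    have h3 := abs_real_inner_le_norm p.snd q.snd
    have h4 := neg_abs_le (inner ℝ p.snd q.snd)
    nlinarith [norm_nonneg p.snd, norm_nonneg q.snd]

/-- The reflection of `𝕄ⁿ` about the hyperplane `π_{v,s}`. -/
def reflect (M : SpaceForm) (v : Direction n) (s : ℝ) (p : Point M n) : Point M n :=
  ⟨p.val - (2 * form M (p.val - geodesic M v s) (velocity M v s)) • velocity M v s,
    reflect_mem M v s p.val p.mem⟩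

/-- The part of the set `T` beyond `π_{v,s}`: the points of `T` that lie on `π_{v,t}` for some
`t > s`. -/
def capOf {M : SpaceForm} (T : Set (Point M n)) (v : Direction n) (s : ℝ) : Set (Point M n) :=
  {p ∈ T | ∃ t ∈ interval M, s < t ∧ p ∈ hyperplane M v t}

/-- The critical value `m_v`: the infimum of the `s` such that for all `t > s` the reflection about
`π_{v,t}` of the part of `∂Ω` beyond `π_{v,t}` is contained in `Ω`. -/
def criticalValue {M : SpaceForm} (Ω : Set (Point M n)) (v : Direction n) : ℝ :=
  sInf {s | s ∈ interval M ∧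
    ∀ t ∈ interval M, s < t → reflect M v t '' capOf (frontier Ω) v t ⊆ Ω}

/-- The maximal cap of `Ω` in the direction `v`: the part of `Ω` beyond the critical hyperplane. -/
def maximalCap {M : SpaceForm} (Ω : Set (Point M n)) (v : Direction n) : Set (Point M n) :=
  capOf Ω v (criticalValue Ω v)

/-! ### Domains with `C²` boundary and deficit functions -/

/-- `S` is a `C²`-regular embedded hypersurface: near each of its points it is the zero set in
`𝕄ⁿ` of a `C²` function whose differential does not vanish on the tangent space of `𝕄ⁿ`. -/
def IsC2Hypersurface {M : SpaceForm} (S : Set (Point M n)) : Prop :=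
  ∀ p ∈ S, ∃ F : Ambient n → ℝ, ContDiffAt ℝ 2 F p.val ∧
    (∃ w ∈ tangent M p.val, fderiv ℝ F p.val w ≠ 0) ∧
    ∀ᶠ q in 𝓝 p, (q ∈ S ↔ F q.val = 0)

/-- The class of relatively compact connected open sets `Ω` of `𝕄ⁿ₊` whose boundary is a connected
closed (i.e. compact) `C²`-regular embedded hypersurface of `𝕄ⁿ₊`. -/
structure Domain (M : SpaceForm) (n : ℕ) where
  region : Set (Point M n)
  isOpen : IsOpen region
  isConnected : IsConnected region
  isCompact_closure : IsCompact (closure region)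
  closure_subset : closure region ⊆ plus M n
  isC2_frontier : IsC2Hypersurface (frontier region)
  isConnected_frontier : IsConnected (frontier region)

lemma Domain.hausdorffEDist_ne_top {M : SpaceForm} (Ω Ω' : Domain M n) :
    Metric.hausdorffEDist Ω.region Ω'.region ≠ ⊤ :=
  Metric.hausdorffEDist_ne_top_of_nonempty_of_bounded Ω.isConnected.nonempty Ω'.isConnected.nonempty
    (Ω.isCompact_closure.isBounded.subset subset_closure)
    (Ω'.isCompact_closure.isBounded.subset subset_closure)

/-- The class of domains with the Hausdorff distance. -/
instance (M : SpaceForm) : PseudoMetricSpace (Domain M n) where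
  dist Ω Ω' := Metric.hausdorffDist Ω.region Ω'.region
  dist_self _ := Metric.hausdorffDist_self_zero
  dist_comm _ _ := Metric.hausdorffDist_comm
  dist_triangle Ω Ω' _ := Metric.hausdorffDist_triangle (Ω.hausdorffEDist_ne_top Ω')

/-- A deficit function: a continuous function `def ≥ 0` on the class of domains (with the topology
of the Hausdorff distance) such that `def Ω = 0` if and only if `Ω` is a ball. -/
structure DeficitFunction (M : SpaceForm) (n : ℕ) where
  toFun : Domain M n → ℝ
  continuous : Continuous toFun
  nonneg : ∀ Ω, 0 ≤ toFun Ω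
  eq_zero_iff : ∀ Ω, toFun Ω = 0 ↔ ∃ O : Point M n, ∃ r : ℝ, 0 < r ∧ Ω.region = Metric.ball O r

/-- Approximate symmetry property with constant `K`: for every direction `v` there is a connected
component `Σ` of the maximal cap such that every point of `Ω` is at distance at most `K * def Ω`
from the union of `Σ` and its reflection about the critical hyperplane. -/
def ApproxSymmetric {M : SpaceForm} (deficit : DeficitFunction M n) (Ω : Domain M n) (K : ℝ) :
    Prop :=
  ∀ v : Direction n, ∃ x ∈ maximalCap Ω.region v, ∀ p ∈ Ω.region,
    Metric.infDist p (connectedComponentIn (maximalCap Ω.region v) x ∪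
      reflect M v (criticalValue Ω.region v) '' connectedComponentIn (maximalCap Ω.region v) x) ≤
        K * deficit.toFun Ω

/-- Uniform touching ball condition of radius `ρ`: every boundary point lies on the boundary of a
ball of radius `ρ` contained in `Ω` and on that of a ball of radius `ρ` in the complement. -/
def TouchingBall {M : SpaceForm} (Ω : Domain M n) (ρ : ℝ) : Prop :=
  ∀ p ∈ frontier Ω.region,
    (∃ c : Point M n, dist p c = ρ ∧ Metric.ball c ρ ⊆ Ω.region) ∧
    (∃ c : Point M n, dist p c = ρ ∧ Disjoint (Metric.ball c ρ) Ω.region)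

/-- The Riemannian volume `|Ω|_g`, i.e. the `n`-dimensional Hausdorff measure of the geodesic
distance, normalised so as to agree with Lebesgue measure on Euclidean space. -/
def Domain.volume {M : SpaceForm} (Ω : Domain M n) : ENNReal := μHE[n] Ω.region

/-- The Riemannian area `|∂Ω|_g`, i.e. the normalised `(n-1)`-dimensional Hausdorff measure. -/
def Domain.area {M : SpaceForm} (Ω : Domain M n) : ENNReal := μHE[n - 1] (frontier Ω.region)

end SpaceForm

end

/-!
A critical hyperplane `π_v` is the position where the moving planes in the direction `v` stop. Up
to that position the reflected cap stays in the closure of `Ω`: for boundary points this is the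
definition, and an interior point is first slid outwards to the boundary
(`reflect_maximalCap_mem_closure`). Hence approximate symmetry says that `Ω` is invariant, up to
`ε = K def(Ω)` in the Hausdorff distance, under the reflections about all the `π_v`
(`ApproxSymmetric.infDist_reflect_le`).

The touching balls bound the area of `∂Ω` near each of its points from below
(`le_measure_frontier`), so with the bound on the total area the `ε`-neighbourhood of `∂Ω` has
volume `O(ε)` (`measure_neighborhood_le`) and `Ω` has bounded diameter (`exists_dist_le`). So `Ω`
and its reflection about `π_v` differ by a set of volume `O(ε)`. Realise the space form in
`ℝ × ℝⁿ`, where the signed height over `π_v` is the restriction of an affine function. It is odd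
under the reflection, so its integral over `Ω` is `O(ε)` (`abs_integral_height_le`). That integral
is a multiple of the height of the centre of mass `𝒪`, the projection of `∫_Ω x` to the space form
(`exists_center`). Therefore every critical hyperplane passes at distance `O(ε)` from the one point
`𝒪`.

If `x ∈ Ω` and `y` have the same distance to `𝒪`, they are exchanged by the reflection about a
hyperplane `π_{v,s}` through `𝒪` (`exists_reflect_eq`). As `π_v` passes close to `𝒪`, the
reflections about `π_{v,s}` and `π_v` are close (`dist_reflect_reflect_le`), so `y` is within `O(ε)` of `Ω`
(`exists_almost_symmetric`): the domain is almost invariant under rotations about `𝒪`. Together with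
the exterior touching balls and the connectedness of `∂Ω` this pinches `∂Ω` between two concentric
spheres (`exists_balls_of_almost_symmetric`). If `ε` is not small, the diameter bound is enough.
-/

namespace SpaceForm

variable {n : ℕ} {M : SpaceForm}

/-! ### Distances, heights and reflections -/

lemma dist_def (p q : Point M n) : dist p q = geoDist M p.val q.val := rfl

lemma dist_euclidean (p q : Point euclidean n) : dist p q = ‖p.val.snd - q.val.snd‖ := rfl

lemma cosh_dist (p q : Point hyperbolic n) :
    Real.cosh (dist p q) = -form hyperbolic p.val q.val :=
  Real.cosh_arcosh (one_le_lorentz _ _ p.mem q.mem)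

lemma cos_dist (p q : Point spherical n) :
    Real.cos (dist p q) = form spherical p.val q.val := by
  rw [dist_def, geoDist_spherical _ _ p.mem q.mem, InnerProductGeometry.cos_angle,
    norm_of_spherical _ p.mem, norm_of_spherical _ q.mem, form_spherical]
  simp

lemma dist_le_pi (p q : Point spherical n) : dist p q ≤ Real.pi := Real.arccos_le_pi _

lemma fst_euclidean (p : Point euclidean n) : p.val.fst = 1 := p.mem

lemma fst_sq_hyperbolic (p : Point hyperbolic n) : p.val.fst ^ 2 = 1 + ‖p.val.snd‖ ^ 2 := by
  have h := p.mem.1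
  simp only [form, real_inner_self_eq_norm_sq] at h
  linarith

lemma fst_sq_spherical (p : Point spherical n) : p.val.fst ^ 2 = 1 - ‖p.val.snd‖ ^ 2 := by
  have h : form spherical p.val p.val = 1 := p.mem
  simp only [form, real_inner_self_eq_norm_sq] at h
  linarith

/-- The Lorentz form expresses the coordinate differences through the hyperbolic distance. -/
lemma norm_snd_sub_sq_hyperbolic (p q : Point hyperbolic n) :
    ‖p.val.snd - q.val.snd‖ ^ 2 =
      2 * (Real.cosh (dist p q) - 1) + (p.val.fst - q.val.fst) ^ 2 := by
  rw [cosh_dist, norm_sub_sq_real]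
  have h1 := fst_sq_hyperbolic p
  have h2 := fst_sq_hyperbolic q
  simp only [form]
  nlinarith

lemma norm_snd_sub_sq_spherical (p q : Point spherical n) :
    ‖p.val.snd - q.val.snd‖ ^ 2 + (p.val.fst - q.val.fst) ^ 2 =
      2 * (1 - Real.cos (dist p q)) := by
  rw [cos_dist, norm_sub_sq_real]
  have h1 := fst_sq_spherical p
  have h2 := fst_sq_spherical q
  simp only [form]
  nlinarith

/-- The generalised cosine: the first coordinate of a geodesic through the base point. -/
noncomputable def cn : SpaceForm → ℝ → ℝ
  | euclidean, _ => 1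
  | hyperbolic, s => Real.cosh s
  | spherical, s => Real.cos s

/-- The generalised sine: the radial coordinate of a geodesic through the base point. -/
noncomputable def sn : SpaceForm → ℝ → ℝ
  | euclidean, s => s
  | hyperbolic, s => Real.sinh s
  | spherical, s => Real.sin s

lemma cn_pos {s : ℝ} (hs : s ∈ interval M) : 0 < cn M s := by
  cases M
  · exact one_pos
  · exact Real.cosh_pos s
  · exact Real.cos_pos_of_mem_Ioo hs

lemma geodesic_fst (v : Direction n) (s : ℝ) : (geodesic M v s).fst = cn M s := by
  cases M <;> rfl

lemma geodesic_snd (v : Direction n) (s : ℝ) : (geodesic M v s).snd = sn M s • v.1 := by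
  cases M <;> rfl

/-- The first coordinate of the velocity of a geodesic through the base point. -/
noncomputable def cnDeriv : SpaceForm → ℝ → ℝ
  | euclidean, _ => 0
  | hyperbolic, s => Real.sinh s
  | spherical, s => -Real.sin s

lemma velocity_fst (v : Direction n) (s : ℝ) : (velocity M v s).fst = cnDeriv M s := by
  cases M <;> rfl

lemma velocity_snd (v : Direction n) (s : ℝ) : (velocity M v s).snd = cn M s • v.1 := by
  cases M
  · exact (one_smul ℝ v.1).symm
  · rfl
  · rfl

lemma continuous_geodesic (v : Direction n) : Continuous (geodesic M v) := by
  cases M <;> unfold geodesic <;>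
    exact (WithLp.prod_continuous_toLp 2 _ _).comp (by fun_prop)

lemma continuous_velocity (v : Direction n) : Continuous (velocity M v) := by
  cases M <;> unfold velocity <;>
    exact (WithLp.prod_continuous_toLp 2 _ _).comp (by fun_prop)

lemma continuous_form (M : SpaceForm) :
    Continuous fun x : Ambient n × Ambient n => form M x.1 x.2 := by
  have h1 : Continuous fun x : Ambient n => x.fst := by fun_prop
  have h2 : Continuous fun x : Ambient n => x.snd := by fun_prop
  cases M <;> simp only [form] <;> fun_prop

lemma norm_direction (v : Direction n) : ‖v.1‖ = 1 := norm_eq_of_mem_sphere v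

/-- The signed height of a point over the hyperplane `π_{v,s}`: up to the monotone change of
variables `sn`, its signed distance to it. -/
noncomputable def height (v : Direction n) (s : ℝ) (p : Point M n) : ℝ :=
  form M (p.val - geodesic M v s) (velocity M v s)

lemma mem_hyperplane {v : Direction n} {s : ℝ} {p : Point M n} :
    p ∈ hyperplane M v s ↔ height v s p = 0 := Iff.rfl

lemma reflect_val (v : Direction n) (s : ℝ) (p : Point M n) :
    (reflect M v s p).val = p.val - (2 * height v s p) • velocity M v s := rfl

lemma height_reflect (v : Direction n) (s : ℝ) (p : Point M n) :
    height v s (reflect M v s p) = -height v s p := by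
  have h : (reflect M v s p).val - geodesic M v s =
      (p.val - geodesic M v s) - (2 * height v s p) • velocity M v s := by
    rw [reflect_val]; abel
  rw [height, h, form_sub_left, form_smul_left, form_velocity]
  change height v s p - _ = _
  ring

lemma reflect_reflect (v : Direction n) (s : ℝ) (p : Point M n) :
    reflect M v s (reflect M v s p) = p := by
  ext1
  rw [reflect_val, height_reflect, reflect_val]
  module

lemma height_of_ne_euclidean (hM : M ≠ euclidean) (v : Direction n) (s : ℝ) (p : Point M n) :
    height v s p = form M p.val (velocity M v s) := by
  rw [height, form_sub_left, form_geodesic_velocity M v s hM, sub_zero]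

lemma form_reflect (hM : M ≠ euclidean) (v : Direction n) (s : ℝ) (p q : Point M n) :
    form M (reflect M v s p).val (reflect M v s q).val = form M p.val q.val := by
  simp only [reflect_val, height_of_ne_euclidean hM, form_sub_left, form_sub_right,
    form_smul_left, form_smul_right, form_velocity, form_comm M (velocity M v s)]
  ring

lemma dist_reflect (v : Direction n) (s : ℝ) (p q : Point M n) :
    dist (reflect M v s p) (reflect M v s q) = dist p q := by
  cases M with
  | euclidean =>
    rw [dist_euclidean, dist_euclidean, ← sq_eq_sq₀ (norm_nonneg _) (norm_nonneg _)]
    set c := inner ℝ (p.val.snd - q.val.snd) v.1 with hc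
    have h : (reflect euclidean v s p).val.snd - (reflect euclidean v s q).val.snd =
        (p.val.snd - q.val.snd) - (2 * c) • v.1 := by
      simp only [reflect_val, height, form, velocity_snd, geodesic_snd, cn, sn, one_smul,
        WithLp.sub_snd, WithLp.smul_snd, hc, inner_sub_left]
      module
    rw [h, norm_sub_sq_real, norm_smul, norm_direction, real_inner_smul_right, ← hc,
      Real.norm_eq_abs, mul_one, sq_abs]
    ring
  | hyperbolic => rw [dist_def, dist_def, geoDist, geoDist, form_reflect (by simp)]
  | spherical => rw [dist_def, dist_def, geoDist, geoDist, form_reflect (by simp)]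

/-- The reflection about `π_{v,s}` as an isometry. -/
noncomputable def reflectEquiv (M : SpaceForm) (v : Direction n) (s : ℝ) :
    Point M n ≃ᵢ Point M n where
  toFun := reflect M v s
  invFun := reflect M v s
  left_inv := reflect_reflect v s
  right_inv := reflect_reflect v s
  isometry_toFun := Isometry.of_dist_eq (dist_reflect v s)

/-- `p = a γ_v(t) + w` with `a > 0` and `w ∈ {0} × v^⊥`; in the Euclidean case `a = 1`. -/
structure Splits (v : Direction n) (p : Point M n) (t a : ℝ) (w : EuclideanSpace ℝ (Fin n)) :
    Prop where
  pos : 0 < a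
  orth : inner ℝ w v.1 = 0
  fst : p.val.fst = a * cn M t
  snd : p.val.snd = (a * sn M t) • v.1 + w
  eq_one : M = euclidean → a = 1

lemma Splits.height {v : Direction n} {p : Point M n} {t a : ℝ} {w : EuclideanSpace ℝ (Fin n)}
    (h : Splits v p t a w) (u : ℝ) : height v u p = a * sn M (t - u) := by
  have hv : inner ℝ v.1 v.1 = (1 : ℝ) := by rw [real_inner_self_eq_norm_sq, norm_direction]; simp
  cases M with
  | euclidean =>
    have ha := h.eq_one rfl
    subst ha
    simp only [SpaceForm.height, form, velocity_snd, geodesic_snd, WithLp.sub_snd, h.snd, sn, cn,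
      inner_sub_left, inner_add_left, real_inner_smul_left, one_smul, hv, h.orth]
    ring
  | hyperbolic =>
    rw [height_of_ne_euclidean (by simp)]
    simp only [form, velocity_snd, velocity_fst, cnDeriv, h.snd, h.fst, sn, cn,
      real_inner_smul_right, inner_add_left, real_inner_smul_left, hv, h.orth, Real.sinh_sub]
    ring
  | spherical =>
    rw [height_of_ne_euclidean (by simp)]
    simp only [form, velocity_snd, velocity_fst, cnDeriv, h.snd, h.fst, sn, cn,
      real_inner_smul_right, inner_add_left, real_inner_smul_left, hv, h.orth, Real.sin_sub]
    ring

lemma cn_reflect (M : SpaceForm) (u t : ℝ) :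
    cn M (2 * u - t) = cn M t - 2 * sn M (t - u) * cnDeriv M u := by
  obtain ⟨s, rfl⟩ : ∃ s, t = u + s := ⟨t - u, by ring⟩
  rw [show 2 * u - (u + s) = u - s by ring, add_sub_cancel_left]
  cases M with
  | euclidean => simp [cn, cnDeriv]
  | hyperbolic => simp only [cn, sn, cnDeriv, Real.cosh_add, Real.cosh_sub]; ring
  | spherical => simp only [cn, sn, cnDeriv, Real.cos_add, Real.cos_sub]; ring

lemma sn_reflect (M : SpaceForm) (u t : ℝ) :
    sn M (2 * u - t) = sn M t - 2 * sn M (t - u) * cn M u := by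
  obtain ⟨s, rfl⟩ : ∃ s, t = u + s := ⟨t - u, by ring⟩
  rw [show 2 * u - (u + s) = u - s by ring, add_sub_cancel_left]
  cases M with
  | euclidean => simp only [cn, sn]; ring
  | hyperbolic => simp only [cn, sn, Real.sinh_add, Real.sinh_sub]; ring
  | spherical => simp only [cn, sn, Real.sin_add, Real.sin_sub]; ring

/-- The reflection about `π_{v,u}` acts on the coordinate along `γ_v` as the reflection in `u`. -/
lemma Splits.reflect {v : Direction n} {p : Point M n} {t a : ℝ} {w : EuclideanSpace ℝ (Fin n)}
    (h : Splits v p t a w) (u : ℝ) : Splits v (reflect M v u p) (2 * u - t) a w := by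
  refine ⟨h.pos, h.orth, ?_, ?_, h.eq_one⟩
  · rw [reflect_val, WithLp.sub_fst, WithLp.smul_fst, h.height, h.fst, velocity_fst, cn_reflect,
      smul_eq_mul]
    ring
  · rw [reflect_val, WithLp.sub_snd, WithLp.smul_snd, h.height, h.snd, velocity_snd, sn_reflect]
    module

/-! ### Topology of the space forms -/

lemma continuous_of_continuous_val {Y : Type*} [TopologicalSpace Y] {f : Y → Point M n}
    (hf : Continuous fun y => (f y).val) : Continuous f := by
  refine continuous_iff_continuousAt.2 fun y => tendsto_iff_dist_tendsto_zero.2 ?_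
  suffices h : Continuous fun z => dist (f z) (f y) by
    have := h.tendsto y
    rwa [dist_self] at this
  have hform : Continuous fun z => form M (f z).val (f y).val :=
    (continuous_form M).comp (hf.prodMk continuous_const)
  cases M with
  | euclidean =>
    simp only [dist_euclidean]
    fun_prop
  | hyperbolic =>
    exact Real.continuousOn_arcosh.comp_continuous hform.neg
      fun z => one_le_lorentz _ _ (f z).mem (f y).mem
  | spherical => exact Real.continuous_arccos.comp hform

lemma continuous_reflect (v : Direction n) (p : Point M n) :
    Continuous fun s => reflect M v s p := by
  apply continuous_of_continuous_val
  have h1 := continuous_geodesic (M := M) v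
  have h2 := continuous_velocity (M := M) v
  have h3 : Continuous fun s => height v s p :=
    (continuous_form M).comp ((continuous_const.sub h1).prodMk h2)
  simp only [reflect_val]
  fun_prop

/-- The base point. -/
noncomputable def origin (M : SpaceForm) (n : ℕ) : Point M n :=
  ⟨WithLp.toLp 2 (1, 0), by cases M <;> simp [carrier, form]⟩

lemma origin_fst : (origin M n).val.fst = 1 := rfl

lemma origin_snd : (origin M n).val.snd = 0 := rfl

lemma cosh_dist_origin (p : Point hyperbolic n) :
    Real.cosh (dist (origin hyperbolic n) p) = p.val.fst := by
  rw [cosh_dist, form, origin_fst, origin_snd]; simp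

lemma cos_dist_origin (p : Point spherical n) :
    Real.cos (dist (origin spherical n) p) = p.val.fst := by
  rw [cos_dist, form, origin_fst, origin_snd]; simp

lemma continuous_fst : Continuous fun p : Point M n => p.val.fst := by
  cases M with
  | euclidean => simp only [fst_euclidean]; exact continuous_const
  | hyperbolic => simp only [← cosh_dist_origin]; fun_prop
  | spherical => simp only [← cos_dist_origin]; fun_prop

lemma continuous_snd : Continuous fun p : Point M n => p.val.snd := by
  refine continuous_iff_continuousAt.2 fun p => tendsto_iff_norm_sub_tendsto_zero.2 ?_
  have hf : Continuous fun q : Point M n => q.val.fst := continuous_fst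
  suffices h : ∃ g : Point M n → ℝ, Continuous g ∧ g p = 0 ∧
      ∀ q, ‖q.val.snd - p.val.snd‖ ≤ g q by
    obtain ⟨g, hg, h0, hle⟩ := h
    exact squeeze_zero (fun _ => norm_nonneg _) hle (h0 ▸ hg.tendsto p)
  cases M with
  | euclidean => exact ⟨fun q => dist q p, by fun_prop, dist_self p, fun q => le_rfl⟩
  | hyperbolic =>
    refine ⟨fun q => √(2 * (Real.cosh (dist q p) - 1) + (q.val.fst - p.val.fst) ^ 2),
      by fun_prop, by simp, fun q => Real.le_sqrt_of_sq_le (norm_snd_sub_sq_hyperbolic q p).le⟩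
  | spherical =>
    refine ⟨fun q => √(2 * (1 - Real.cos (dist q p))), by fun_prop, by simp,
      fun q => Real.le_sqrt_of_sq_le ?_⟩
    nlinarith [norm_snd_sub_sq_spherical q p, sq_nonneg (q.val.fst - p.val.fst)]

lemma continuous_val : Continuous fun p : Point M n => p.val :=
  (WithLp.prod_continuous_toLp 2 _ _).comp (continuous_fst.prodMk continuous_snd)

lemma fst_pos_of_ne_spherical (hM : M ≠ spherical) (p : Point M n) : 0 < p.val.fst := by
  cases M with
  | euclidean => rw [fst_euclidean]; exact one_pos
  | hyperbolic => exact p.mem.2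
  | spherical => exact absurd rfl hM

/-! ### Splitting along a geodesic -/

lemma norm_splits_sq {v : Direction n} {w : EuclideanSpace ℝ (Fin n)} (hw : inner ℝ w v.1 = 0)
    (c : ℝ) : ‖c • v.1 + w‖ ^ 2 = c ^ 2 + ‖w‖ ^ 2 := by
  rw [norm_add_sq_real, real_inner_smul_left, real_inner_comm, hw, norm_smul, norm_direction,
    Real.norm_eq_abs, mul_one, sq_abs]
  ring

lemma Splits.sq_hyperbolic {v : Direction n} {p : Point hyperbolic n} {t a : ℝ}
    {w : EuclideanSpace ℝ (Fin n)} (h : Splits v p t a w) : a ^ 2 = 1 + ‖w‖ ^ 2 := by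
  have h1 := fst_sq_hyperbolic p
  rw [h.fst, h.snd, norm_splits_sq h.orth, cn, sn] at h1
  nlinarith [Real.cosh_sq t]

lemma Splits.sq_spherical {v : Direction n} {p : Point spherical n} {t a : ℝ}
    {w : EuclideanSpace ℝ (Fin n)} (h : Splits v p t a w) : a ^ 2 = 1 - ‖w‖ ^ 2 := by
  have h1 := fst_sq_spherical p
  rw [h.fst, h.snd, norm_splits_sq h.orth, cn, sn] at h1
  nlinarith [Real.sin_sq_add_cos_sq t]

lemma Splits.dist_euclidean {v : Direction n} {p q : Point euclidean n} {t s a : ℝ}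
    {w : EuclideanSpace ℝ (Fin n)} (hp : Splits v p t a w) (hq : Splits v q s a w) :
    dist p q = |t - s| := by
  have ha := hp.eq_one rfl
  rw [SpaceForm.dist_euclidean, hp.snd, hq.snd, ha,
    show ((1 * sn euclidean t) • v.1 + w) - ((1 * sn euclidean s) • v.1 + w) = (t - s) • v.1 by
      simp only [sn]; module, norm_smul, norm_direction, mul_one, Real.norm_eq_abs]

lemma Splits.inner_snd {v : Direction n} {p q : Point M n} {t s a b : ℝ}
    {w z : EuclideanSpace ℝ (Fin n)} (hp : Splits v p t a w) (hq : Splits v q s b z) :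
    inner ℝ p.val.snd q.val.snd = (a * sn M t) * (b * sn M s) + inner ℝ w z := by
  have hv : inner ℝ v.1 v.1 = (1 : ℝ) := by rw [real_inner_self_eq_norm_sq, norm_direction]; simp
  have hz : inner ℝ v.1 z = 0 := by rw [real_inner_comm, hq.orth]
  rw [hp.snd, hq.snd]
  simp only [inner_add_left, inner_add_right, real_inner_smul_left, real_inner_smul_right, hv,
    hp.orth, hz]
  ring

lemma Splits.cosh_dist {v : Direction n} {p q : Point hyperbolic n} {t s a b : ℝ}
    {w z : EuclideanSpace ℝ (Fin n)} (hp : Splits v p t a w) (hq : Splits v q s b z) :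
    Real.cosh (dist p q) = a * b * Real.cosh (t - s) - inner ℝ w z := by
  rw [SpaceForm.cosh_dist, form, hp.inner_snd hq, hp.fst, hq.fst, Real.cosh_sub, cn, sn, cn, sn]
  ring

lemma Splits.cos_dist {v : Direction n} {p q : Point spherical n} {t s a b : ℝ}
    {w z : EuclideanSpace ℝ (Fin n)} (hp : Splits v p t a w) (hq : Splits v q s b z) :
    Real.cos (dist p q) = a * b * Real.cos (t - s) + inner ℝ w z := by
  rw [SpaceForm.cos_dist, form, hp.inner_snd hq, hp.fst, hq.fst, Real.cos_sub, cn, sn, cn, sn]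
  ring

lemma Splits.mem_hyperplane {v : Direction n} {p : Point M n} {t a : ℝ}
    {w : EuclideanSpace ℝ (Fin n)} (h : Splits v p t a w) : p ∈ hyperplane M v t := by
  rw [SpaceForm.mem_hyperplane, h.height, sub_self]
  cases M <;> simp [sn]

lemma height_eq_zero_iff (v : Direction n) (t : ℝ) (p : Point M n) :
    height v t p = 0 ↔ inner ℝ p.val.snd v.1 * cn M t = p.val.fst * sn M t := by
  have hv : inner ℝ v.1 v.1 = (1 : ℝ) := by rw [real_inner_self_eq_norm_sq, norm_direction]; simp
  cases M with
  | euclidean =>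
    simp only [height, form, velocity_snd, geodesic_snd, WithLp.sub_snd, inner_sub_left,
      real_inner_smul_left, cn, sn, one_smul, hv, fst_euclidean, sub_eq_zero, mul_one, one_mul]
  | hyperbolic =>
    rw [height_of_ne_euclidean (by simp)]
    simp only [form, velocity_snd, velocity_fst, cnDeriv, cn, sn, real_inner_smul_right,
      sub_eq_zero]
    rw [mul_comm]
  | spherical =>
    rw [height_of_ne_euclidean (by simp)]
    simp only [form, velocity_snd, velocity_fst, cnDeriv, cn, sn, real_inner_smul_right]
    constructor <;> intro h <;> linarith

lemma exists_splits_of_mem_hyperplane {v : Direction n} {p : Point M n} {t : ℝ}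
    (hp : p ∈ plus M n) (ht : t ∈ interval M) (h : p ∈ hyperplane M v t) :
    ∃ a w, Splits v p t a w := by
  have hc := cn_pos ht
  have h1 := (height_eq_zero_iff v t p).1 h
  have hv : inner ℝ v.1 v.1 = (1 : ℝ) := by rw [real_inner_self_eq_norm_sq, norm_direction]; simp
  have h2 : inner ℝ p.val.snd v.1 = p.val.fst / cn M t * sn M t := by
    field_simp
    linarith
  refine ⟨p.val.fst / cn M t, p.val.snd - (p.val.fst / cn M t * sn M t) • v.1,
    div_pos hp hc, ?_, ?_, ?_, ?_⟩
  · rw [inner_sub_left, real_inner_smul_left, hv, h2]; ring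
  · field_simp
  · module
  · rintro rfl
    simp [fst_euclidean, cn]

/-- Every point of `𝕄ⁿ₊` lies on one of the hyperplanes orthogonal to a given geodesic. -/
lemma exists_splits (v : Direction n) {p : Point M n} (hp : p ∈ plus M n) :
    ∃ t ∈ interval M, ∃ a w, Splits v p t a w := by
  suffices h : ∃ t ∈ interval M, p ∈ hyperplane M v t by
    obtain ⟨t, ht, h⟩ := h
    exact ⟨t, ht, exists_splits_of_mem_hyperplane hp ht h⟩
  simp only [mem_hyperplane, height_eq_zero_iff]
  have hp' : 0 < p.val.fst := hp
  set x := inner ℝ p.val.snd v.1 with hx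
  cases M with
  | euclidean => exact ⟨x, trivial, by simp [cn, sn, fst_euclidean]⟩
  | hyperbolic =>
    have h1 := fst_sq_hyperbolic p
    have h2 : x ^ 2 ≤ ‖p.val.snd‖ ^ 2 := by
      have := abs_real_inner_le_norm p.val.snd v.1
      rw [norm_direction, mul_one, ← hx] at this
      exact sq_le_sq' (by linarith [neg_abs_le x]) (by linarith [le_abs_self x])
    set s := √(p.val.fst ^ 2 - x ^ 2) with hs
    have hs2 : s ^ 2 = p.val.fst ^ 2 - x ^ 2 := Real.sq_sqrt (by linarith)
    have hs0 : 0 < s := Real.sqrt_pos.2 (by linarith)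
    refine ⟨Real.arsinh (x / s), trivial, ?_⟩
    rw [cn, sn, Real.sinh_arsinh, Real.cosh_arsinh,
      show 1 + (x / s) ^ 2 = (p.val.fst / s) ^ 2 by field_simp; linarith,
      Real.sqrt_sq (by positivity)]
    ring
  | spherical =>
    refine ⟨Real.arctan (x / p.val.fst),
      ⟨Real.neg_pi_div_two_lt_arctan _, Real.arctan_lt_pi_div_two _⟩, ?_⟩
    have hc := Real.cos_arctan_pos (x / p.val.fst)
    have h := Real.tan_arctan (x / p.val.fst)
    rw [Real.tan_eq_sin_div_cos, div_eq_div_iff hc.ne' hp'.ne'] at h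
    rw [cn, sn]
    linarith

/-- Sliding a point along the curve orthogonal to the hyperplanes `π_{v,s}`. -/
lemma Splits.slide {v : Direction n} {p : Point M n} {t a : ℝ} {w : EuclideanSpace ℝ (Fin n)}
    (h : Splits v p t a w) (s : ℝ) :
    Splits v (SpaceForm.reflect M v ((s + t) / 2) p) s a w := by
  have := h.reflect ((s + t) / 2)
  rwa [show 2 * ((s + t) / 2) - t = s by ring] at this

lemma Splits.unique {v : Direction n} {p q : Point M n} {t a : ℝ}
    {w : EuclideanSpace ℝ (Fin n)} (hp : Splits v p t a w) (hq : Splits v q t a w) : p = q :=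
  Point.ext (ambient_ext (by rw [hp.fst, hq.fst]) (by rw [hp.snd, hq.snd]))

lemma exists_mem_frontier_of_isPreconnected {X : Type*} [TopologicalSpace X] {C U : Set X}
    (hC : IsPreconnected C) {x y : X} (hx : x ∈ C) (hxU : x ∈ U) (hy : y ∈ C) (hyU : y ∉ U) :
    ∃ z ∈ C, z ∈ frontier U := by
  by_contra! hc
  obtain ⟨z, -, hz1, hz2⟩ := hC (interior U) (closure U)ᶜ
    isOpen_interior isClosed_closure.isOpen_compl
    (fun z hz => by
      by_cases h : z ∈ closure U
      · exact Or.inl (by_contra fun h' => hc z hz ⟨h, h'⟩)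
      · exact Or.inr h)
    ⟨x, hx, by_contra fun h' => hc x hx ⟨subset_closure hxU, h'⟩⟩
    ⟨y, hy, fun h' => hc y hy ⟨h', fun h => hyU (interior_subset h)⟩⟩
  exact hz2 (interior_subset.trans subset_closure hz1)

/-! ### Geodesics and homogeneity -/

/-- The points of the geodesic `γ_v`. -/
noncomputable def geodesicPoint (M : SpaceForm) (v : Direction n) (s : ℝ) : Point M n :=
  ⟨geodesic M v s, by
    have hv := norm_direction v
    have h1 := Real.cosh_sq s
    have h2 := Real.sin_sq_add_cos_sq s
    have h3 := Real.cosh_pos s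
    cases M <;> simp [carrier, form, geodesic, norm_smul, hv] <;> (try constructor) <;> nlinarith⟩

lemma splits_geodesicPoint (v : Direction n) (s : ℝ) :
    Splits v (geodesicPoint M v s) s 1 0 :=
  ⟨one_pos, inner_zero_left _, by rw [one_mul]; exact geodesic_fst v s,
    by rw [one_mul, add_zero]; exact geodesic_snd v s, fun _ => rfl⟩

lemma geodesicPoint_zero (v : Direction n) : geodesicPoint M v 0 = origin M n := by
  refine Point.ext (ambient_ext ?_ ?_)
  · rw [origin_fst]; cases M <;> simp [geodesicPoint, geodesic]
  · rw [origin_snd]; cases M <;> simp [geodesicPoint, geodesic]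

lemma splits_origin (v : Direction n) : Splits v (origin M n) 0 1 0 := by
  rw [← geodesicPoint_zero v]
  exact splits_geodesicPoint v 0

lemma dist_geodesicPoint (v : Direction n) (s t : ℝ)
    (h : M = spherical → |s - t| ≤ Real.pi) :
    dist (geodesicPoint M v s) (geodesicPoint M v t) = |s - t| := by
  have hs := splits_geodesicPoint (M := M) v s
  have ht := splits_geodesicPoint (M := M) v t
  cases M with
  | euclidean => exact hs.dist_euclidean ht
  | hyperbolic =>
    have h1 := hs.cosh_dist ht
    rw [inner_zero_left, sub_zero, one_mul, one_mul, ← Real.cosh_abs (s - t)] at h1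
    exact Real.cosh_injOn dist_nonneg (abs_nonneg (s - t)) h1
  | spherical =>
    have h1 := hs.cos_dist ht
    rw [inner_zero_left, add_zero, one_mul, one_mul, ← Real.cos_abs (s - t)] at h1
    exact Real.injOn_cos ⟨dist_nonneg, dist_le_pi _ _⟩ ⟨abs_nonneg _, h rfl⟩ h1

lemma norm_snd_eq (p : Point M n) : ‖p.val.snd‖ = sn M (dist (origin M n) p) := by
  cases M with
  | euclidean => rw [dist_euclidean, origin_snd, zero_sub, norm_neg]; rfl
  | hyperbolic =>
    have h1 := fst_sq_hyperbolic p
    rw [← cosh_dist_origin, Real.cosh_sq] at h1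
    exact (sq_eq_sq₀ (norm_nonneg _) (Real.sinh_nonneg_iff.2 dist_nonneg)).1 (by linarith)
  | spherical =>
    have h1 := fst_sq_spherical p
    rw [← cos_dist_origin] at h1
    exact (sq_eq_sq₀ (norm_nonneg _)
      (Real.sin_nonneg_of_nonneg_of_le_pi dist_nonneg (dist_le_pi _ _))).1
      (by linarith [Real.sin_sq_add_cos_sq (dist (origin spherical n) p)])

lemma fst_eq (p : Point M n) : p.val.fst = cn M (dist (origin M n) p) := by
  cases M with
  | euclidean => exact fst_euclidean p
  | hyperbolic => exact (cosh_dist_origin p).symm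
  | spherical => exact (cos_dist_origin p).symm

/-- Polar coordinates around the base point. -/
lemma exists_eq_geodesicPoint (hn : n ≠ 0) (p : Point M n) :
    ∃ v : Direction n, p = geodesicPoint M v (dist (origin M n) p) := by
  have : NeZero n := ⟨hn⟩
  obtain ⟨v, hv⟩ : ∃ v : Direction n, p.val.snd = ‖p.val.snd‖ • v.1 := by
    by_cases h0 : p.val.snd = 0
    · refine ⟨⟨EuclideanSpace.single 0 1, by simp⟩, ?_⟩
      rw [h0]; simp
    · refine ⟨⟨‖p.val.snd‖⁻¹ • p.val.snd, ?_⟩, ?_⟩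
      · rw [mem_sphere_zero_iff_norm, norm_smul, norm_inv, norm_norm,
          inv_mul_cancel₀ (norm_ne_zero_iff.2 h0)]
      · change _ = _ • (_ • _)
        rw [smul_inv_smul₀ (norm_ne_zero_iff.2 h0)]
  refine ⟨v, Point.ext (ambient_ext ?_ ?_)⟩
  · rw [fst_eq p]; exact (geodesic_fst _ _).symm
  · rw [hv, norm_snd_eq]; exact (geodesic_snd _ _).symm

/-- The isometries act transitively. -/
lemma exists_isometryEquiv_origin (hn : n ≠ 0) (p : Point M n) :
    ∃ g : Point M n ≃ᵢ Point M n, g p = origin M n := by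
  obtain ⟨v, hv⟩ := exists_eq_geodesicPoint hn p
  set d := dist (origin M n) p
  refine ⟨reflectEquiv M v (d / 2), ?_⟩
  have h := (splits_geodesicPoint (M := M) v d).slide 0
  rw [← hv, zero_add] at h
  exact h.unique (splits_origin v)

/-- `τ` is a length up to which every geodesic is minimising. -/
def IsRadius (M : SpaceForm) (τ : ℝ) : Prop := 0 ≤ τ ∧ (M = spherical → τ ≤ Real.pi)

lemma isRadius_dist (p q : Point M n) : IsRadius M (dist p q) :=
  ⟨dist_nonneg, by rintro rfl; exact dist_le_pi p q⟩

lemma IsRadius.mono {τ σ : ℝ} (h : IsRadius M τ) (h0 : 0 ≤ σ) (hle : σ ≤ τ) : IsRadius M σ :=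
  ⟨h0, fun hM => hle.trans (h.2 hM)⟩

/-- Through any two points there is a minimising geodesic ray, and it continues beyond the second
one as long as geodesics minimise. -/
lemma exists_ray (hn : n ≠ 0) (p q : Point M n) :
    ∃ e : ℝ → Point M n, e 0 = p ∧ e (dist p q) = q ∧
      ∀ s t, IsRadius M s → IsRadius M t → dist (e s) (e t) = |s - t| := by
  obtain ⟨g, hg⟩ := exists_isometryEquiv_origin hn p
  obtain ⟨v, hv⟩ := exists_eq_geodesicPoint hn (g q)
  rw [← hg, g.dist_eq] at hv
  refine ⟨fun s => g.symm (geodesicPoint M v s), ?_, ?_, fun s t hs ht => ?_⟩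
  · change g.symm _ = p
    rw [geodesicPoint_zero, ← hg, g.symm_apply_apply]
  · change g.symm _ = q
    rw [← hv, g.symm_apply_apply]
  · rw [g.symm.dist_eq]
    refine dist_geodesicPoint v s t fun hM => abs_sub_le_iff.2 ⟨?_, ?_⟩
    · linarith [hs.2 hM, ht.1]
    · linarith [ht.2 hM, hs.1]

/-- On a sphere around `p` there is a point whose distance to `q` is the difference of the radii. -/
lemma exists_dist_eq (hn : n ≠ 0) (p q : Point M n) {τ : ℝ} (hτ : IsRadius M τ) :
    ∃ y, dist p y = τ ∧ dist y q = |τ - dist p q| := by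
  obtain ⟨e, h0, h1, he⟩ := exists_ray hn p q
  refine ⟨e τ, ?_, ?_⟩
  · rw [← h0, he 0 τ (hτ.mono le_rfl hτ.1) hτ, zero_sub, abs_neg, abs_of_nonneg hτ.1]
  · conv_lhs => rw [← h1]
    exact he _ _ hτ (isRadius_dist p q)

/-- Minimising segments, as connected sets. -/
lemma exists_isPreconnected_segment (hn : n ≠ 0) (p q : Point M n) :
    ∃ C : Set (Point M n), IsPreconnected C ∧ p ∈ C ∧ q ∈ C ∧ ∀ z ∈ C, dist p z ≤ dist p q := by
  obtain ⟨e, h0, h1, he⟩ := exists_ray hn p q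
  have hI : ∀ s ∈ Set.Icc 0 (dist p q), IsRadius M s := fun s hs =>
    (isRadius_dist p q).mono hs.1 hs.2
  refine ⟨e '' Set.Icc 0 (dist p q), ?_, ⟨0, ⟨le_rfl, dist_nonneg⟩, h0⟩,
    ⟨_, ⟨dist_nonneg, le_rfl⟩, h1⟩, ?_⟩
  · refine isPreconnected_Icc.image _ ?_
    refine LipschitzOnWith.continuousOn (K := 1)
      (LipschitzOnWith.of_dist_le_mul fun s hs t ht => ?_)
    rw [he s t (hI s hs) (hI t ht), Real.dist_eq]
    simp
  · rintro _ ⟨s, hs, rfl⟩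
    have := he 0 s (hI 0 ⟨le_rfl, dist_nonneg⟩) (hI s hs)
    rw [h0, zero_sub, abs_neg, abs_of_nonneg hs.1] at this
    linarith [hs.2]

lemma isPreconnected_ball (hn : n ≠ 0) (p : Point M n) (r : ℝ) :
    IsPreconnected (Metric.ball p r) := by
  refine isPreconnected_of_forall p fun q hq => ?_
  obtain ⟨C, hC, hp, hqC, hd⟩ := exists_isPreconnected_segment hn p q
  refine ⟨C, fun z hz => ?_, hp, hqC, hC⟩
  rw [Metric.mem_ball, dist_comm] at hq ⊢
  exact (hd z hz).trans_lt hq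

/-- A closed ball touching from inside at `p` contains smaller ones touching at `p`. -/
lemma exists_smaller_touching_ball (hn : n ≠ 0) {p c : Point M n} {ρ s : ℝ} (h : dist p c = ρ)
    (hs0 : 0 ≤ s) (hs : s ≤ ρ) :
    ∃ c', dist p c' = s ∧ Metric.ball c' s ⊆ Metric.ball c ρ := by
  have hρ : IsRadius M ρ := h ▸ isRadius_dist p c
  obtain ⟨y, hy, hyc⟩ := exists_dist_eq hn p c (hρ.mono hs0 hs)
  refine ⟨y, hy, Metric.ball_subset_ball' ?_⟩
  rw [hyc, h, abs_of_nonpos (by linarith)]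
  linarith

/-- A set that meets a frontier-free ball contains it. -/
lemma ball_subset_of_frontier (hn : n ≠ 0) {U : Set (Point M n)} {p : Point M n} {r : ℝ}
    (hU : (Metric.ball p r ∩ U).Nonempty) (hf : ∀ x ∈ frontier U, r ≤ dist x p) :
    Metric.ball p r ⊆ U := by
  intro y hy
  by_contra hyU
  obtain ⟨z, hz, hzU⟩ := hU
  obtain ⟨x, hx, hx'⟩ :=
    exists_mem_frontier_of_isPreconnected (isPreconnected_ball hn p r) hz hzU hy hyU
  exact (hf x hx').not_gt hx

/-- A minimising geodesic from a point of `U` to a point outside meets the frontier. -/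
lemma exists_frontier_of_dist (hn : n ≠ 0) {U : Set (Point M n)} {x y : Point M n}
    (hx : x ∉ U) (hy : y ∈ closure U) : ∃ z ∈ frontier U, dist x z ≤ dist x y := by
  by_contra! hc
  have hyU : y ∈ U := by
    by_contra hyU
    exact lt_irrefl _ (hc y ⟨hy, fun h => hyU (interior_subset h)⟩)
  obtain ⟨C, hC, hxC, hyC, hd⟩ := exists_isPreconnected_segment hn x y
  obtain ⟨z, hz, hz'⟩ := exists_mem_frontier_of_isPreconnected hC hyC hyU hxC hx
  exact (hc z hz').not_ge (hd z hz)

/-- The distance to a point has no local maximum away from the antipode. -/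
lemma exists_dist_gt (hn : n ≠ 0) (p x : Point M n) (hx : M = spherical → dist p x < Real.pi)
    {U : Set (Point M n)} (hU : IsOpen U) (hxU : x ∈ U) : ∃ y ∈ U, dist p x < dist p y := by
  obtain ⟨e, h0, h1, he⟩ := exists_ray hn p x
  obtain ⟨ε, hε, hball⟩ := Metric.isOpen_iff.1 hU x hxU
  obtain ⟨σ, hσ, hσε, hσr⟩ : ∃ σ > 0, σ < ε ∧ IsRadius M (dist p x + σ) := by
    by_cases hM : M = spherical
    · refine ⟨min (ε / 2) (Real.pi - dist p x), lt_min (by linarith) (by linarith [hx hM]),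
        (min_le_left _ _).trans_lt (by linarith), ?_, fun _ => ?_⟩
      · have := lt_min (half_pos hε) (sub_pos.2 (hx hM))
        linarith [dist_nonneg (x := p) (y := x)]
      · linarith [min_le_right (ε / 2) (Real.pi - dist p x)]
    · exact ⟨ε / 2, half_pos hε, half_lt_self hε,
        by linarith [dist_nonneg (x := p) (y := x)], fun h => absurd h hM⟩
  refine ⟨e (dist p x + σ), hball ?_, ?_⟩
  · have h2 := he _ _ hσr (isRadius_dist p x)
    rw [h1, add_sub_cancel_left, abs_of_pos hσ] at h2
    rw [Metric.mem_ball, h2]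
    exact hσε
  · have h2 := he 0 _ ((isRadius_dist p x).mono le_rfl dist_nonneg) hσr
    rw [h0, zero_sub, abs_neg, abs_of_nonneg hσr.1] at h2
    linarith

/-! ### Vertical projection as a bi-Lipschitz chart -/

lemma abs_sinh_le {z : ℝ} (hz : |z| ≤ 1) : |Real.sinh z| ≤ 2 * |z| := by
  have h1 := Real.abs_exp_sub_one_le hz
  have h2 := Real.abs_exp_sub_one_le (x := -z) (by rwa [abs_neg])
  rw [abs_neg] at h2
  rw [Real.sinh_eq, show (Real.exp z - Real.exp (-z)) / 2 =
    ((Real.exp z - 1) - (Real.exp (-z) - 1)) / 2 by ring, abs_div, abs_two]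
  have := abs_sub (Real.exp z - 1) (Real.exp (-z) - 1)
  linarith

lemma cosh_sub_one (z : ℝ) : Real.cosh z - 1 = 2 * Real.sinh (z / 2) ^ 2 := by
  have h := Real.cosh_two_mul (z / 2)
  rw [mul_div_cancel₀ z two_ne_zero, Real.cosh_sq] at h
  linarith

lemma sq_div_two_le_cosh_sub_one {z : ℝ} (hz : 0 ≤ z) : z ^ 2 / 2 ≤ Real.cosh z - 1 := by
  have h := Real.self_le_sinh_iff.2 (div_nonneg hz zero_le_two)
  rw [cosh_sub_one]
  nlinarith

lemma norm_snd_sub_le {p q : Point M n} (hp : dist (origin M n) p < 1)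
    (hq : dist (origin M n) q < 1) : ‖p.val.snd - q.val.snd‖ ≤ 5 * dist p q := by
  have hd := dist_nonneg (x := p) (y := q)
  have hd2 : dist p q ≤ 2 := by
    have := dist_triangle_left p q (origin M n)
    linarith
  refine abs_le_of_sq_le_sq' ?_ (by positivity) |>.2
  cases M with
  | euclidean => rw [← dist_euclidean]; nlinarith
  | hyperbolic =>
    set r := dist (origin hyperbolic n) p with hr
    set r' := dist (origin hyperbolic n) q with hr'
    have hr0 : 0 ≤ r := dist_nonneg
    have hr0' : 0 ≤ r' := dist_nonneg
    have hrr : |r - r'| ≤ dist p q := by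
      rw [hr, hr', dist_comm _ p, dist_comm _ q]
      exact abs_dist_sub_le p q _
    have h1 : p.val.fst - q.val.fst =
        2 * Real.sinh ((r + r') / 2) * Real.sinh ((r - r') / 2) := by
      rw [← cosh_dist_origin, ← cosh_dist_origin, ← hr, ← hr']
      have e1 : r = (r + r') / 2 + (r - r') / 2 := by ring
      have e2 : r' = (r + r') / 2 - (r - r') / 2 := by ring
      conv_lhs => rw [e1]
      conv_lhs => enter [2]; rw [e2]
      rw [Real.cosh_add, Real.cosh_sub]
      ring
    have h2 : |Real.sinh ((r + r') / 2)| ≤ 2 := by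
      have h := abs_sinh_le (z := (r + r') / 2) (by rw [abs_of_nonneg (by positivity)]; linarith)
      rw [abs_of_nonneg (a := (r + r') / 2) (by positivity)] at h
      linarith
    have h3 : |Real.sinh ((r - r') / 2)| ≤ dist p q := by
      have h := abs_sinh_le (z := (r - r') / 2) (by rw [abs_div, abs_two]; linarith)
      rw [abs_div, abs_two] at h
      linarith
    have h4 : |Real.sinh (dist p q / 2)| ≤ dist p q := by
      have h := abs_sinh_le (z := dist p q / 2) (by rw [abs_of_nonneg (by positivity)]; linarith)
      rw [abs_of_nonneg (a := dist p q / 2) (by positivity)] at h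
      linarith
    rw [norm_snd_sub_sq_hyperbolic, cosh_sub_one, h1]
    have h5 : Real.sinh ((r + r') / 2) ^ 2 ≤ 2 ^ 2 := sq_le_sq.2 (by rwa [abs_two])
    have h6 : Real.sinh ((r - r') / 2) ^ 2 ≤ dist p q ^ 2 := sq_le_sq.2 (by rwa [abs_of_nonneg hd])
    have h7 : Real.sinh (dist p q / 2) ^ 2 ≤ dist p q ^ 2 := sq_le_sq.2 (by rwa [abs_of_nonneg hd])
    have h8 := mul_le_mul h5 h6 (sq_nonneg _) (by norm_num)
    nlinarith
  | spherical =>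
    have h1 := norm_snd_sub_sq_spherical p q
    have h2 := Real.one_sub_sq_div_two_le_cos (x := dist p q)
    nlinarith [sq_nonneg (p.val.fst - q.val.fst)]

/-- The height of the carrier over a point of the unit ball of `ℝⁿ`. -/
noncomputable def chartHeight : SpaceForm → EuclideanSpace ℝ (Fin n) → ℝ
  | euclidean, _ => 1
  | hyperbolic, u => √(1 + ‖u‖ ^ 2)
  | spherical, u => √(1 - ‖u‖ ^ 2)

lemma mem_carrier_of_norm_le {u : EuclideanSpace ℝ (Fin n)} (hu : ‖u‖ ≤ 1) :
    WithLp.toLp 2 (chartHeight M u, u) ∈ carrier M := by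
  cases M with
  | euclidean => rfl
  | hyperbolic =>
    have h : 0 < 1 + ‖u‖ ^ 2 := by positivity
    refine ⟨?_, Real.sqrt_pos.2 h⟩
    change inner ℝ u u - √(1 + ‖u‖ ^ 2) * √(1 + ‖u‖ ^ 2) = -1
    rw [real_inner_self_eq_norm_sq, Real.mul_self_sqrt h.le]
    ring
  | spherical =>
    have h : 0 ≤ 1 - ‖u‖ ^ 2 := by nlinarith [norm_nonneg u]
    change inner ℝ u u + √(1 - ‖u‖ ^ 2) * √(1 - ‖u‖ ^ 2) = 1
    rw [real_inner_self_eq_norm_sq, Real.mul_self_sqrt h]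
    ring

open Classical in
/-- The inverse of the vertical projection to `ℝⁿ` over the unit ball; outside of it the value is
irrelevant. -/
noncomputable def chart (M : SpaceForm) (u : EuclideanSpace ℝ (Fin n)) : Point M n :=
  if h : ‖u‖ ≤ 1 then ⟨WithLp.toLp 2 (chartHeight M u, u), mem_carrier_of_norm_le h⟩
  else origin M n

lemma chart_snd {u : EuclideanSpace ℝ (Fin n)} (hu : ‖u‖ ≤ 1) : (chart M u).val.snd = u := by
  rw [chart, dif_pos hu]; rfl

lemma chart_fst {u : EuclideanSpace ℝ (Fin n)} (hu : ‖u‖ ≤ 1) :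
    (chart M u).val.fst = chartHeight M u := by
  rw [chart, dif_pos hu]; rfl

lemma chart_zero : chart M (0 : EuclideanSpace ℝ (Fin n)) = origin M n := by
  refine Point.ext (ambient_ext ?_ (by rw [chart_snd (by simp), origin_snd]))
  rw [chart_fst (by simp), origin_fst]
  cases M <;> simp [chartHeight]

lemma chart_snd_self {p : Point M n} (hp : 0 < p.val.fst) (h : ‖p.val.snd‖ ≤ 1) :
    chart M p.val.snd = p := by
  refine Point.ext (ambient_ext ?_ (chart_snd h))
  rw [chart_fst h]
  cases M with
  | euclidean => exact (fst_euclidean p).symm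
  | hyperbolic => rw [chartHeight, ← fst_sq_hyperbolic, Real.sqrt_sq hp.le]
  | spherical => rw [chartHeight, ← fst_sq_spherical, Real.sqrt_sq hp.le]

lemma dist_chart_le {u u' : EuclideanSpace ℝ (Fin n)} (hu : ‖u‖ ≤ 1 / 2) (hu' : ‖u'‖ ≤ 1 / 2) :
    dist (chart M u) (chart M u') ≤ 3 * ‖u - u'‖ := by
  have h1 := chart_snd (M := M) (hu.trans (by norm_num))
  have h2 := chart_snd (M := M) (hu'.trans (by norm_num))
  refine abs_le_of_sq_le_sq' ?_ (by positivity) |>.2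
  cases M with
  | euclidean => rw [dist_euclidean, h1, h2]; nlinarith [sq_nonneg ‖u - u'‖]
  | hyperbolic =>
    have h := norm_snd_sub_sq_hyperbolic (chart hyperbolic u) (chart hyperbolic u')
    rw [h1, h2] at h
    have := sq_div_two_le_cosh_sub_one
      (dist_nonneg (x := chart hyperbolic u) (y := chart hyperbolic u'))
    nlinarith [sq_nonneg ‖u - u'‖,
      sq_nonneg ((chart hyperbolic u).val.fst - (chart hyperbolic u').val.fst)]
  | spherical =>
    have h := norm_snd_sub_sq_spherical (chart spherical u) (chart spherical u')
    have hc := Real.cos_le_one_sub_mul_cos_sq (x := dist (chart spherical u) (chart spherical u'))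
      (by rw [abs_of_nonneg dist_nonneg]; exact dist_le_pi _ _)
    have f1 := fst_sq_spherical (chart spherical u)
    have f2 := fst_sq_spherical (chart spherical u')
    have g1 : 1 / 2 ≤ (chart spherical u).val.fst := by
      rw [chart_fst (hu.trans (by norm_num)), chartHeight]
      exact Real.le_sqrt_of_sq_le (by nlinarith [norm_nonneg u])
    have g2 : 1 / 2 ≤ (chart spherical u').val.fst := by
      rw [chart_fst (hu'.trans (by norm_num)), chartHeight]
      exact Real.le_sqrt_of_sq_le (by nlinarith [norm_nonneg u'])
    rw [h1] at f1 h
    rw [h2] at f2 h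
    set a := (chart spherical u).val.fst
    set a' := (chart spherical u').val.fst
    set d := dist (chart spherical u) (chart spherical u')
    have hn : |‖u‖ - ‖u'‖| ≤ ‖u - u'‖ := abs_norm_sub_norm_le u u'
    have key : |a - a'| ≤ ‖u - u'‖ := by
      have e : (a - a') * (a + a') = -((‖u‖ - ‖u'‖) * (‖u‖ + ‖u'‖)) := by linarith
      have e2 := congrArg abs e
      rw [abs_mul, abs_neg, abs_mul, abs_of_nonneg (a := a + a') (by linarith),
        abs_of_nonneg (a := ‖u‖ + ‖u'‖) (by positivity)] at e2
      nlinarith [abs_nonneg (a - a'), abs_nonneg (‖u‖ - ‖u'‖)]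
    have key2 : (a - a') ^ 2 ≤ ‖u - u'‖ ^ 2 := sq_le_sq.2 (by rwa [abs_of_nonneg (norm_nonneg _)])
    have hpi : Real.pi ^ 2 ≤ 18 := by nlinarith [Real.pi_lt_d2, Real.pi_pos]
    have h3 : 2 / Real.pi ^ 2 * d ^ 2 ≤ ‖u - u'‖ ^ 2 := by linarith
    have h4 : d ^ 2 ≤ ‖u - u'‖ ^ 2 * (Real.pi ^ 2 / 2) := by
      have := mul_le_mul_of_nonneg_right h3 (show 0 ≤ Real.pi ^ 2 / 2 by positivity)
      rwa [show 2 / Real.pi ^ 2 * d ^ 2 * (Real.pi ^ 2 / 2) = d ^ 2 by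
        field_simp] at this
    nlinarith [sq_nonneg ‖u - u'‖]

lemma fst_pos_of_dist_lt {p : Point M n} (hp : dist (origin M n) p < 1) : 0 < p.val.fst := by
  by_cases hM : M = spherical
  · subst hM
    rw [← cos_dist_origin]
    exact Real.cos_pos_of_mem_Ioo ⟨by linarith [dist_nonneg (x := origin spherical n) (y := p),
      Real.pi_gt_three], by linarith [Real.pi_gt_three]⟩
  · exact fst_pos_of_ne_spherical hM p

lemma norm_snd_le {p : Point M n} (hp : dist (origin M n) p < 1) :
    ‖p.val.snd‖ ≤ 5 * dist (origin M n) p := by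
  have := norm_snd_sub_le (p := origin M n) (by simp) hp
  rwa [origin_snd, zero_sub, norm_neg] at this

lemma dist_origin_chart_le {u : EuclideanSpace ℝ (Fin n)} (hu : ‖u‖ ≤ 1 / 2) :
    dist (origin M n) (chart M u) ≤ 3 * ‖u‖ := by
  have := dist_chart_le (M := M) (u := 0) (by simp) hu
  rwa [chart_zero, zero_sub, norm_neg] at this

/-! ### Volumes and areas of small pieces -/

lemma measure_lipschitz_image_le {X Y : Type*} [MetricSpace X] [MeasurableSpace X] [BorelSpace X]
    [MetricSpace Y] [MeasurableSpace Y] [BorelSpace Y] {K : ℝ} (hK : 0 ≤ K) {f : X → Y} {s : Set X}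
    (h : ∀ x ∈ s, ∀ y ∈ s, dist (f x) (f y) ≤ K * dist x y) (d : ℕ) :
    μHE[d] (f '' s) ≤ ENNReal.ofReal (K ^ d) * μHE[d] s := by
  lift K to NNReal using hK
  have h1 := (LipschitzOnWith.of_dist_le_mul h).hausdorffMeasure_image_le (d := d)
    (Nat.cast_nonneg d)
  rw [ENNReal.rpow_natCast] at h1
  rw [← NNReal.coe_pow, ENNReal.ofReal_coe_nnreal, ENNReal.coe_pow]
  simp only [MeasureTheory.Measure.euclideanHausdorffMeasure_def, MeasureTheory.Measure.smul_apply,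
    ENNReal.smul_def, smul_eq_mul]
  calc _ ≤ _ * ((K : ENNReal) ^ d * μH[(d : ℝ)] s) := by gcongr
    _ = _ := by ring

/-- The volume of the unit ball of `ℝⁿ`. -/
noncomputable def unitBallVolume (n : ℕ) : ℝ :=
  (MeasureTheory.volume (Metric.ball (0 : EuclideanSpace ℝ (Fin n)) 1)).toReal

lemma unitBallVolume_pos (n : ℕ) : 0 < unitBallVolume n :=
  ENNReal.toReal_pos (Metric.measure_ball_pos _ _ one_pos).ne' MeasureTheory.measure_ball_lt_top.ne

lemma measure_euclidean_ball (x : EuclideanSpace ℝ (Fin n)) {r : ℝ} (hr : 0 < r) :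
    μHE[n] (Metric.ball x r) = ENNReal.ofReal (r ^ n * unitBallVolume n) := by
  rw [EuclideanSpace.euclideanHausdorffMeasure_eq_volume,
    MeasureTheory.Measure.addHaar_ball_of_pos _ x hr, finrank_euclideanSpace_fin,
    ENNReal.ofReal_mul (by positivity), unitBallVolume,
    ENNReal.ofReal_toReal MeasureTheory.measure_ball_lt_top.ne]

lemma measure_ball_eq (hn : n ≠ 0) (p : Point M n) (t : ℝ) (d : ℕ) :
    μHE[d] (Metric.ball p t) = μHE[d] (Metric.ball (origin M n) t) := by
  obtain ⟨g, hg⟩ := exists_isometryEquiv_origin hn p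
  rw [← hg, ← g.image_ball, g.isometry.euclideanHausdorffMeasure_image]

lemma measure_ball_le (hn : n ≠ 0) (p : Point M n) {t : ℝ} (ht0 : 0 < t) (ht : t ≤ 1 / 10) :
    μHE[n] (Metric.ball p t) ≤ ENNReal.ofReal ((15 * t) ^ n * unitBallVolume n) := by
  rw [measure_ball_eq hn]
  have hsub : Metric.ball (origin M n) t ⊆
      chart M '' Metric.ball (0 : EuclideanSpace ℝ (Fin n)) (5 * t) := by
    intro x hx
    rw [Metric.mem_ball, dist_comm] at hx
    have h1 := norm_snd_le (p := x) (by linarith)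
    refine ⟨x.val.snd, ?_, chart_snd_self (fst_pos_of_dist_lt (by linarith)) (by linarith)⟩
    rw [mem_ball_zero_iff]
    linarith
  refine (MeasureTheory.measure_mono hsub).trans
    ((measure_lipschitz_image_le (K := 3) (by norm_num) (fun x hx y hy => ?_) n).trans ?_)
  · rw [mem_ball_zero_iff] at hx hy
    rw [dist_eq_norm x y]
    exact dist_chart_le (by linarith) (by linarith)
  · rw [measure_euclidean_ball _ (by positivity), ← ENNReal.ofReal_mul (by positivity)]
    refine ENNReal.ofReal_le_ofReal (le_of_eq ?_)
    rw [← mul_assoc, ← mul_pow]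
    ring_nf

lemma le_measure_ball (hn : n ≠ 0) (p : Point M n) {t : ℝ} (ht0 : 0 < t) (ht : t ≤ 1) :
    ENNReal.ofReal ((t / 15) ^ n * unitBallVolume n) ≤ μHE[n] (Metric.ball p t) := by
  rw [measure_ball_eq hn]
  have hsub : Metric.ball (0 : EuclideanSpace ℝ (Fin n)) (t / 3) ⊆
      (fun x : Point M n => x.val.snd) '' Metric.ball (origin M n) t := by
    intro u hu
    rw [mem_ball_zero_iff] at hu
    have h1 := dist_origin_chart_le (M := M) (u := u) (by linarith)
    refine ⟨chart M u, ?_, chart_snd (by linarith)⟩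
    rw [Metric.mem_ball, dist_comm]
    linarith
  have h := (MeasureTheory.measure_mono hsub).trans
    (measure_lipschitz_image_le (K := 5) (by norm_num) (fun x hx y hy => by
      rw [Metric.mem_ball, dist_comm] at hx hy
      rw [dist_eq_norm]
      exact norm_snd_sub_le (by linarith) (by linarith)) n)
  rw [measure_euclidean_ball _ (by positivity)] at h
  calc ENNReal.ofReal ((t / 15) ^ n * unitBallVolume n)
      = ENNReal.ofReal ((1 / 5) ^ n) * ENNReal.ofReal ((t / 3) ^ n * unitBallVolume n) := by
        rw [← ENNReal.ofReal_mul (by positivity), ← mul_assoc, ← mul_pow]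
        ring_nf
    _ ≤ ENNReal.ofReal ((1 / 5) ^ n) *
        (ENNReal.ofReal (5 ^ n) * μHE[n] (Metric.ball (origin M n) t)) := by gcongr
    _ = _ := by
        rw [← mul_assoc, ← ENNReal.ofReal_mul (by positivity), ← mul_pow]
        norm_num

/-- Orthogonal projection along a vector, with an isometric section. -/
lemma exists_projection {m : ℕ} {d : EuclideanSpace ℝ (Fin (m + 1))} (hd : d ≠ 0) :
    ∃ (π : EuclideanSpace ℝ (Fin (m + 1)) →ₗ[ℝ] EuclideanSpace ℝ (Fin m))
      (ι : EuclideanSpace ℝ (Fin m) →ₗ[ℝ] EuclideanSpace ℝ (Fin (m + 1))),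
      (∀ y, π (ι y) = y) ∧ π d = 0 ∧ (∀ x, ‖π x‖ ≤ ‖x‖) ∧ ∀ y, ‖ι y‖ = ‖y‖ := by
  have : Fact (Module.finrank ℝ (EuclideanSpace ℝ (Fin (m + 1))) = m + 1) := ⟨by simp⟩
  let W := (Submodule.span ℝ {d})ᗮ
  let b := OrthonormalBasis.fromOrthogonalSpanSingleton (𝕜 := ℝ) m hd
  refine ⟨b.repr.toLinearEquiv.toLinearMap ∘ₗ W.orthogonalProjectionOnto.toLinearMap,
    W.subtype ∘ₗ b.repr.symm.toLinearEquiv.toLinearMap, fun y => ?_, ?_, fun x => ?_, fun y => ?_⟩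
  · simp [W]
  · have : W.orthogonalProjectionOnto d = 0 := by
      apply Submodule.orthogonalProjectionOnto_orthogonal_apply_eq_zero
      exact Submodule.mem_span_singleton_self d
    simp [this]
  · simp only [LinearMap.comp_apply, LinearEquiv.coe_coe, LinearIsometryEquiv.coe_toLinearEquiv,
      LinearIsometryEquiv.norm_map]
    exact W.norm_orthogonalProjectionOnto_apply_le x
  · exact b.repr.symm.norm_map y

/-- Lower area density: a set with an interior and an exterior ball touching at `p` has a
definite amount of frontier near `p`, since the frontier separates the two balls, and hence its
projection along the line of the centres covers a disc. -/
lemma le_measure_frontier (hn : n ≠ 0) {U : Set (Point M n)} {p c c' : Point M n} {s : ℝ}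
    (hs0 : 0 < s) (hs : s ≤ 1 / 20) (hc : dist p c = s) (hc' : dist p c' = s)
    (hin : Metric.ball c s ⊆ U) (hout : Disjoint (Metric.ball c' s) U) :
    ENNReal.ofReal ((s / 15) ^ (n - 1) * unitBallVolume (n - 1)) ≤
      μHE[n - 1] (frontier U ∩ Metric.ball p (18 * s)) := by
  wlog hp : p = origin M n generalizing U p c c'
  · obtain ⟨g, hg⟩ := exists_isometryEquiv_origin hn p
    have h := this (U := g '' U) (p := g p) (c := g c) (c' := g c') (by rwa [g.dist_eq])
      (by rwa [g.dist_eq]) (by rw [← g.image_ball]; exact Set.image_mono hin)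
      (by rw [← g.image_ball]; exact (Set.disjoint_image_iff g.injective).2 hout) hg
    have hf : frontier (g '' U) = g '' frontier U := (g.toHomeomorph.image_frontier U).symm
    rwa [hf, ← g.image_ball, ← Set.image_inter g.injective,
      g.isometry.euclideanHausdorffMeasure_image] at h
  subst hp
  obtain ⟨m, rfl⟩ := Nat.exists_eq_succ_of_ne_zero hn
  have hu := norm_snd_le (p := c) (by linarith)
  have hu' := norm_snd_le (p := c') (by linarith)
  have hcc := chart_snd_self (fst_pos_of_dist_lt (p := c) (by linarith)) (by linarith)
  have hcc' := chart_snd_self (fst_pos_of_dist_lt (p := c') (by linarith)) (by linarith)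
  rw [hc] at hu
  rw [hc'] at hu'
  set u := c.val.snd with hudef
  set u' := c'.val.snd with hudef'
  have hne : u' - u ≠ 0 := by
    intro h
    rw [sub_eq_zero] at h
    have hcceq : c' = c := by rw [← hcc, ← hcc', h]
    exact Set.disjoint_left.1 hout (Metric.mem_ball_self hs0)
      (hcceq ▸ hin (Metric.mem_ball_self hs0))
  obtain ⟨π, ι, hπι, hπ0, hπ, hι⟩ := exists_projection hne
  have hsub : Metric.ball (π u) (s / 3) ⊆ (fun x : Point M (m + 1) => π x.val.snd) ''
      (frontier U ∩ Metric.ball (origin M (m + 1)) (18 * s)) := by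
    intro y hy
    rw [Metric.mem_ball, dist_eq_norm] at hy
    set w := ι (y - π u) with hw
    have hwn : ‖w‖ < s / 3 := by rw [hw, hι]; exact hy
    have hball : ∀ z ∈ segment ℝ (u + w) (u' + w), ‖z‖ < 6 * s := by
      intro z hz
      have h1 : u + w ∈ Metric.ball (0 : EuclideanSpace ℝ (Fin (m + 1))) (6 * s) := by
        rw [mem_ball_zero_iff]; linarith [norm_add_le u w]
      have h2 : u' + w ∈ Metric.ball (0 : EuclideanSpace ℝ (Fin (m + 1))) (6 * s) := by
        rw [mem_ball_zero_iff]; linarith [norm_add_le u' w]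
      exact mem_ball_zero_iff.1 ((convex_ball _ _).segment_subset h1 h2 hz)
    have hpre : IsPreconnected (chart M '' segment ℝ (u + w) (u' + w)) := by
      refine (convex_segment _ _).isPreconnected.image _ ?_
      refine LipschitzOnWith.continuousOn (K := 3)
        (LipschitzOnWith.of_dist_le_mul fun x hx y hy => ?_)
      rw [dist_eq_norm x y]
      exact dist_chart_le (by linarith [hball x hx]) (by linarith [hball y hy])
    have hmem : chart M (u + w) ∈ U := by
      refine hin ?_
      rw [Metric.mem_ball]
      conv_lhs => rw [← hcc]
      have := dist_chart_le (M := M) (u := u + w) (u' := u)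
        (by linarith [hball _ (left_mem_segment ℝ _ _)]) (by linarith)
      rw [add_sub_cancel_left] at this
      linarith
    have hmem' : chart M (u' + w) ∉ U := by
      refine Set.disjoint_left.1 hout ?_
      rw [Metric.mem_ball]
      conv_lhs => rw [← hcc']
      have := dist_chart_le (M := M) (u := u' + w) (u' := u')
        (by linarith [hball _ (right_mem_segment ℝ _ _)]) (by linarith)
      rw [add_sub_cancel_left] at this
      linarith
    obtain ⟨_, ⟨z, hz, rfl⟩, hzf⟩ := exists_mem_frontier_of_isPreconnected hpre
      ⟨_, left_mem_segment ℝ _ _, rfl⟩ hmem ⟨_, right_mem_segment ℝ _ _, rfl⟩ hmem'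
    have hz6 := hball z hz
    refine ⟨chart M z, ⟨hzf, ?_⟩, ?_⟩
    · rw [Metric.mem_ball, dist_comm]
      linarith [dist_origin_chart_le (M := M) (u := z) (by linarith)]
    · change π (chart M z).val.snd = y
      rw [chart_snd (by linarith)]
      rw [segment_eq_image'] at hz
      obtain ⟨θ, -, rfl⟩ := hz
      rw [show u' + w - (u + w) = u' - u by abel, map_add, map_add, map_smul, hπ0, hw, hπι]
      simp
  have h := (MeasureTheory.measure_mono hsub).trans
    (measure_lipschitz_image_le (K := 5) (by norm_num) (fun x hx y hy => by
      have hx := hx.2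
      have hy := hy.2
      rw [Metric.mem_ball, dist_comm] at hx hy
      rw [dist_eq_norm, ← map_sub]
      exact (hπ _).trans (norm_snd_sub_le (by linarith) (by linarith))) m)
  rw [measure_euclidean_ball _ (by positivity)] at h
  change ENNReal.ofReal ((s / 15) ^ m * unitBallVolume m) ≤
      μHE[m] (frontier U ∩ Metric.ball (origin M (m + 1)) (18 * s))
  calc ENNReal.ofReal ((s / 15) ^ m * unitBallVolume m)
      = ENNReal.ofReal ((1 / 5) ^ m) * ENNReal.ofReal ((s / 3) ^ m * unitBallVolume m) := by
        rw [← ENNReal.ofReal_mul (by positivity), ← mul_assoc, ← mul_pow]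
        ring_nf
    _ ≤ ENNReal.ofReal ((1 / 5) ^ m) * (ENNReal.ofReal (5 ^ m) *
        μHE[m] (frontier U ∩ Metric.ball (origin M (m + 1)) (18 * s))) := by gcongr
    _ = _ := by
        rw [← mul_assoc, ← ENNReal.ofReal_mul (by positivity), ← mul_pow]
        norm_num

/-! ### Packing arguments -/

lemma card_mul_le_of_separated {X ι : Type*} [MetricSpace X] [MeasurableSpace X] [BorelSpace X]
    (ν : MeasureTheory.Measure X) {S : Set X} (hS : IsClosed S) {r m A : ℝ}
    (hA : 0 ≤ A) (hν : ν S ≤ ENNReal.ofReal A) (F : Finset ι) (f : ι → X)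
    (hsep : ∀ i ∈ F, ∀ j ∈ F, i ≠ j → 2 * r ≤ dist (f i) (f j))
    (hf : ∀ i ∈ F, ENNReal.ofReal m ≤ ν (S ∩ Metric.ball (f i) r)) : F.card * m ≤ A := by
  have hdisj : (F : Set ι).PairwiseDisjoint fun i => S ∩ Metric.ball (f i) r := by
    intro i hi j hj hij
    refine Disjoint.mono Set.inter_subset_right Set.inter_subset_right
      (Metric.ball_disjoint_ball ?_)
    linarith [hsep i hi j hj hij]
  have h1 : ν (⋃ i ∈ F, S ∩ Metric.ball (f i) r) = ∑ i ∈ F, ν (S ∩ Metric.ball (f i) r) :=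
    MeasureTheory.measure_biUnion_finset hdisj fun i _ =>
      hS.measurableSet.inter Metric.isOpen_ball.measurableSet
  have h2 : ν (⋃ i ∈ F, S ∩ Metric.ball (f i) r) ≤ ν S :=
    MeasureTheory.measure_mono (Set.iUnion₂_subset fun _ _ => Set.inter_subset_left)
  have h3 : (F.card : ENNReal) * ENNReal.ofReal m ≤ ENNReal.ofReal A := by
    rw [← nsmul_eq_mul]
    exact (Finset.card_nsmul_le_sum F _ _ hf).trans ((h1 ▸ h2).trans hν)
  rw [← ENNReal.ofReal_natCast, ← ENNReal.ofReal_mul (by positivity)] at h3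
  exact (ENNReal.ofReal_le_ofReal_iff hA).1 h3

/-- A maximal separated set is a net. -/
lemma exists_finite_net {X : Type*} [MetricSpace X] {S : Set X} {r : ℝ} {N : ℕ}
    (hN : ∀ F : Finset X, (∀ x ∈ F, x ∈ S) → (∀ x ∈ F, ∀ y ∈ F, x ≠ y → r ≤ dist x y) →
      F.card ≤ N) :
    ∃ F : Finset X, (∀ x ∈ F, x ∈ S) ∧ (∀ x ∈ F, ∀ y ∈ F, x ≠ y → r ≤ dist x y) ∧
      ∀ x ∈ S, x ∈ F ∨ ∃ y ∈ F, dist x y < r := by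
  classical
  set T := {k | ∃ F : Finset X, (∀ x ∈ F, x ∈ S) ∧
    (∀ x ∈ F, ∀ y ∈ F, x ≠ y → r ≤ dist x y) ∧ F.card = k} with hT
  have hb : BddAbove T := ⟨N, by rintro k ⟨F, h1, h2, rfl⟩; exact hN F h1 h2⟩
  have hne : T.Nonempty := ⟨0, ∅, by simp⟩
  obtain ⟨F, h1, h2, h3⟩ := Nat.sSup_mem hne hb
  refine ⟨F, h1, h2, fun x hx => ?_⟩
  by_contra! hc
  have hmem : F.card + 1 ∈ T := by
    refine ⟨insert x F, ?_, ?_, Finset.card_insert_of_notMem hc.1⟩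
    · intro y hy
      rcases Finset.mem_insert.1 hy with rfl | hy
      exacts [hx, h1 y hy]
    · intro y hy z hz hyz
      rcases Finset.mem_insert.1 hy with rfl | hy' <;> rcases Finset.mem_insert.1 hz with rfl | hz'
      · exact absurd rfl hyz
      · exact hc.2 z hz'
      · rw [dist_comm]; exact hc.2 y hy'
      · exact h2 y hy' z hz' hyz
  have := le_csSup hb hmem
  omega

/-- A lower bound for the area of the frontier near its points at all small scales gives a linear
bound for the volume of its tubular neighbourhoods. -/
lemma measure_neighborhood_le (hn : n ≠ 0) {S : Set (Point M n)} (hS : IsClosed S) {A : ℝ}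
    (hA : 0 ≤ A) (hSA : μHE[n - 1] S ≤ ENNReal.ofReal A) {ε : ℝ} (hε0 : 0 < ε)
    (hε : ε ≤ 1 / 380)
    (hd : ∀ p ∈ S, ENNReal.ofReal ((ε / 15) ^ (n - 1) * unitBallVolume (n - 1)) ≤
      μHE[n - 1] (S ∩ Metric.ball p (18 * ε))) :
    μHE[n] {x : Point M n | ∃ z ∈ S, dist x z ≤ ε} ≤
      ENNReal.ofReal (A * 570 ^ n * 15 ^ (n - 1) * unitBallVolume n /
        unitBallVolume (n - 1) * ε) := by
  set m := (ε / 15) ^ (n - 1) * unitBallVolume (n - 1) with hm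
  have hm0 : 0 < m := mul_pos (by positivity) (unitBallVolume_pos _)
  have hcard : ∀ F : Finset (Point M n), (∀ x ∈ F, x ∈ S) →
      (∀ x ∈ F, ∀ y ∈ F, x ≠ y → 36 * ε ≤ dist x y) → F.card * m ≤ A := fun F h1 h2 =>
    card_mul_le_of_separated μHE[n - 1] hS hA hSA F id (r := 18 * ε)
      (fun x hx y hy hxy => by have := h2 x hx y hy hxy; simp only [id]; linarith)
      fun x hx => hd x (h1 x hx)
  obtain ⟨F, h1, h2, h3⟩ := exists_finite_net (S := S) (r := 36 * ε) (N := ⌊A / m⌋₊)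
    fun F h1 h2 => Nat.le_floor ((le_div_iff₀ hm0).2 (hcard F h1 h2))
  have hsub : {x : Point M n | ∃ z ∈ S, dist x z ≤ ε} ⊆
      ⋃ y ∈ F, Metric.ball y (38 * ε) := by
    rintro x ⟨z, hz, hxz⟩
    simp only [Set.mem_iUnion]
    rcases h3 z hz with h | ⟨y, hy, hzy⟩
    · exact ⟨z, h, by rw [Metric.mem_ball]; linarith⟩
    · exact ⟨y, hy, by rw [Metric.mem_ball]; linarith [dist_triangle x z y]⟩
  have hω := unitBallVolume_pos n
  have hω' := unitBallVolume_pos (n - 1)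
  calc μHE[n] {x : Point M n | ∃ z ∈ S, dist x z ≤ ε}
      ≤ ∑ y ∈ F, μHE[n] (Metric.ball y (38 * ε)) :=
        (MeasureTheory.measure_mono hsub).trans (MeasureTheory.measure_biUnion_finset_le _ _)
    _ ≤ F.card • ENNReal.ofReal ((15 * (38 * ε)) ^ n * unitBallVolume n) :=
        Finset.sum_le_card_nsmul _ _ _ fun y _ => measure_ball_le hn y (by linarith) (by linarith)
    _ = ENNReal.ofReal (F.card * ((570 * ε) ^ n * unitBallVolume n)) := by
        rw [nsmul_eq_mul, ← ENNReal.ofReal_natCast, ← ENNReal.ofReal_mul (by positivity)]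
        ring_nf
    _ ≤ _ := by
        refine ENNReal.ofReal_le_ofReal ?_
        have h4 : (F.card : ℝ) ≤ A / m := (le_div_iff₀ hm0).2 (hcard F h1 h2)
        calc (F.card : ℝ) * ((570 * ε) ^ n * unitBallVolume n)
            ≤ A / m * ((570 * ε) ^ n * unitBallVolume n) := by gcongr
          _ = _ := by
            obtain ⟨k, rfl⟩ := Nat.exists_eq_succ_of_ne_zero hn
            rw [hm, div_pow]
            simp only [Nat.succ_eq_add_one, Nat.add_sub_cancel]
            field_simp
            ring

/-- A connected set of bounded area with a lower area density bound has bounded diameter. -/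
lemma dist_le_of_density {X : Type*} [MetricSpace X] [MeasurableSpace X] [BorelSpace X]
    (ν : MeasureTheory.Measure X) {S : Set X} (hS : IsClosed S) (hconn : IsPreconnected S)
    {r m A : ℝ} (hr : 0 < r) (hm : 0 < m) (hA : 0 ≤ A) (hν : ν S ≤ ENNReal.ofReal A)
    (hd : ∀ p ∈ S, ENNReal.ofReal m ≤ ν (S ∩ Metric.ball p r)) {p q : X} (hp : p ∈ S)
    (hq : q ∈ S) : dist p q ≤ 2 * r * (A / m) := by
  have hex : ∀ k : ℕ, k ≤ ⌊dist p q / (2 * r)⌋₊ → ∃ x ∈ S, dist p x = 2 * r * k := by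
    intro k hk
    have hk' : 2 * r * k ≤ dist p q := by
      have := (Nat.le_floor_iff (by positivity)).1 hk
      rw [le_div_iff₀ (by positivity)] at this
      linarith
    obtain ⟨x, hx, hx'⟩ := hconn.intermediate_value hp hq
      (f := fun x => dist p x) (by fun_prop) (show 2 * r * k ∈ Set.Icc (dist p p) (dist p q) from
        ⟨by rw [dist_self]; positivity, hk'⟩)
    exact ⟨x, hx, hx'⟩
  have : Nonempty X := ⟨p⟩
  choose! f hfS hf using hex
  have hcard := card_mul_le_of_separated ν hS hA hν
    (Finset.range (⌊dist p q / (2 * r)⌋₊ + 1)) f (r := r)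
    (fun i hi j hj hij => by
      have hi' := hf i (by simpa [Nat.lt_succ_iff] using hi)
      have hj' := hf j (by simpa [Nat.lt_succ_iff] using hj)
      have h1 : |dist p (f i) - dist p (f j)| ≤ dist (f i) (f j) := by
        rw [dist_comm p, dist_comm p]; exact abs_dist_sub_le _ _ _
      rw [hi', hj', ← mul_sub, abs_mul, abs_of_pos (by positivity : 0 < 2 * r)] at h1
      have h2 : (1 : ℝ) ≤ |(i : ℝ) - j| := by
        have h3 : (1 : ℤ) ≤ |(i : ℤ) - j| := Int.one_le_abs (by omega)
        exact_mod_cast h3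
      nlinarith)
    fun i hi => hd _ (hfS i (by simpa [Nat.lt_succ_iff] using hi))
  rw [Finset.card_range] at hcard
  push_cast at hcard
  have h1 := Nat.lt_floor_add_one (dist p q / (2 * r))
  rw [div_lt_iff₀ (by positivity)] at h1
  have h2 := (le_div_iff₀ hm).2 hcard
  nlinarith

lemma TouchingBall.le_measure_frontier (hn : n ≠ 0) {Ω : Domain M n} {ρ : ℝ}
    (h : TouchingBall Ω ρ) {s : ℝ} (hs0 : 0 < s) (hs : s ≤ 1 / 20) (hsρ : s ≤ ρ) {p : Point M n}
    (hp : p ∈ frontier Ω.region) :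
    ENNReal.ofReal ((s / 15) ^ (n - 1) * unitBallVolume (n - 1)) ≤
      μHE[n - 1] (frontier Ω.region ∩ Metric.ball p (18 * s)) := by
  obtain ⟨⟨c, hc, hcΩ⟩, c', hc', hcΩ'⟩ := h p hp
  obtain ⟨b, hb, hbc⟩ := exists_smaller_touching_ball hn hc hs0.le hsρ
  obtain ⟨b', hb', hbc'⟩ := exists_smaller_touching_ball hn hc' hs0.le hsρ
  exact SpaceForm.le_measure_frontier hn hs0 hs hb hb' (hbc.trans hcΩ) (hcΩ'.mono_left hbc')

/-- The distance to a point attains its maximum over the closure of a domain on the frontier. -/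
lemma exists_farthest (hn : n ≠ 0) (Ω : Domain M n) (p : Point M n)
    (hp : M = spherical → ∀ x ∈ Ω.region, dist p x < Real.pi) :
    ∃ q ∈ frontier Ω.region, ∀ x ∈ closure Ω.region, dist p x ≤ dist p q := by
  obtain ⟨q, hq, hmax⟩ := Ω.isCompact_closure.exists_isMaxOn
    Ω.isConnected.nonempty.closure (f := fun x => dist p x) (by fun_prop)
  refine ⟨q, ⟨hq, fun hi => ?_⟩, hmax⟩
  rw [Ω.isOpen.interior_eq] at hi
  obtain ⟨y, hy, hlt⟩ := exists_dist_gt hn p q (fun hM => hp hM q hi) Ω.isOpen hi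
  exact (hmax (subset_closure hy)).not_gt hlt

/-- The diameter bound for domains with touching balls and bounded area. -/
lemma exists_dist_le (hn : n ≠ 0) {ρ A : ℝ} (hρ : 0 < ρ) (hA : 0 < A) :
    ∃ L : ℝ, 0 < L ∧ ∀ (M : SpaceForm) (Ω : Domain M n), TouchingBall Ω ρ →
      Ω.area ≤ ENNReal.ofReal A → ∀ x ∈ closure Ω.region, ∀ y ∈ closure Ω.region,
        dist x y ≤ L := by
  set s := min ρ (1 / 20) with hs
  have hs0 : 0 < s := lt_min hρ (by norm_num)
  set m := (s / 15) ^ (n - 1) * unitBallVolume (n - 1) with hm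
  have hm0 : 0 < m := mul_pos (by positivity) (unitBallVolume_pos _)
  refine ⟨max Real.pi (2 * (18 * s) * (A / m)), lt_max_of_lt_left Real.pi_pos, ?_⟩
  intro M Ω hT hΩA x hx y hy
  by_cases hM : M = spherical
  · subst hM
    exact (dist_le_pi x y).trans (le_max_left _ _)
  refine le_trans ?_ (le_max_right _ _)
  have hS : ∀ p ∈ frontier Ω.region, ∀ q ∈ frontier Ω.region,
      dist p q ≤ 2 * (18 * s) * (A / m) := fun p hp q hq =>
    dist_le_of_density μHE[n - 1] isClosed_frontier Ω.isConnected_frontier.isPreconnected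
      (by positivity) hm0 hA.le hΩA
      (fun p hp => hT.le_measure_frontier hn hs0 (min_le_right _ _) (min_le_left _ _) hp) hp hq
  obtain ⟨q, hq, hxq⟩ := exists_farthest hn Ω x (fun h => absurd h hM)
  obtain ⟨q', hq', hqq⟩ := exists_farthest hn Ω q (fun h => absurd h hM)
  calc dist x y ≤ dist x q := hxq y hy
    _ = dist q x := dist_comm _ _
    _ ≤ dist q q' := hqq x hx
    _ ≤ _ := hS q hq q' hq'

/-! ### The maximal cap -/

lemma exists_coordinate_bound (Ω : Domain M n) (v : Direction n) :
    ∃ s ∈ interval M, ∀ p ∈ closure Ω.region, ∀ t ∈ interval M, p ∈ hyperplane M v t → t ≤ s := by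
  by_cases hM : M = spherical
  · subst hM
    obtain ⟨q, hq, hmin⟩ := Ω.isCompact_closure.exists_isMinOn
      Ω.isConnected.nonempty.closure (f := fun x => x.val.fst) continuous_fst.continuousOn
    have hq0 : 0 < q.val.fst := Ω.closure_subset hq
    refine ⟨Real.arccos q.val.fst, ⟨?_, Real.arccos_lt_pi_div_two.2 hq0⟩, fun p hp t ht hpt => ?_⟩
    · linarith [Real.arccos_nonneg q.val.fst, Real.pi_pos]
    obtain ⟨a, w, h⟩ := exists_splits_of_mem_hyperplane (Ω.closure_subset hp) ht hpt
    rcases le_total t 0 with ht0 | ht0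
    · exact ht0.trans (Real.arccos_nonneg _)
    have ha1 : a ≤ 1 := by nlinarith [h.sq_spherical, h.pos, sq_nonneg ‖w‖]
    have hle : q.val.fst ≤ Real.cos t := by
      have h1 : q.val.fst ≤ p.val.fst := hmin hp
      rw [h.fst] at h1
      have h2 : 0 < cn spherical t := cn_pos ht
      change q.val.fst ≤ cn spherical t
      nlinarith
    rw [← Real.arccos_cos ht0 (by linarith [ht.2, Real.pi_pos])]
    exact Real.arccos_le_arccos hle
  · obtain ⟨q, -, hmax⟩ := Ω.isCompact_closure.exists_isMaxOn
      Ω.isConnected.nonempty.closure (f := fun x => dist (origin M n) x) (by fun_prop)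
    refine ⟨dist (origin M n) q, ?_, fun p hp t ht hpt => ?_⟩
    · cases M
      · trivial
      · trivial
      · exact absurd rfl hM
    refine le_trans ?_ (hmax hp)
    obtain ⟨a, w, h⟩ := exists_splits_of_mem_hyperplane (Ω.closure_subset hp) ht hpt
    have h0 := splits_origin (M := M) v
    cases M with
    | euclidean =>
      have h1 := norm_snd_eq p
      have h2 := norm_splits_sq h.orth (a * sn euclidean t)
      rw [← h.snd, h1, h.eq_one rfl, one_mul] at h2
      change dist (origin euclidean n) p ^ 2 = t ^ 2 + _ at h2
      have h3 : t ^ 2 ≤ dist (origin euclidean n) p ^ 2 := by linarith [sq_nonneg ‖w‖]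
      exact abs_le_of_sq_le_sq' h3 dist_nonneg |>.2
    | hyperbolic =>
      have h1 := h0.cosh_dist h
      rw [inner_zero_left, sub_zero, one_mul, zero_sub, Real.cosh_neg] at h1
      have ha1 : 1 ≤ a := by nlinarith [h.sq_hyperbolic, h.pos, sq_nonneg ‖w‖]
      have h2 : Real.cosh t ≤ Real.cosh (dist (origin hyperbolic n) p) := by
        rw [h1]; nlinarith [Real.cosh_pos t]
      rw [Real.cosh_le_cosh, abs_of_nonneg (dist_nonneg (x := origin hyperbolic n))] at h2
      exact (le_abs_self t).trans h2
    | spherical => exact absurd rfl hM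

lemma critical_set_nonempty (Ω : Domain M n) (v : Direction n) :
    {s | s ∈ interval M ∧ ∀ t ∈ interval M, s < t →
      reflect M v t '' capOf (frontier Ω.region) v t ⊆ Ω.region}.Nonempty := by
  obtain ⟨s, hs, hb⟩ := exists_coordinate_bound Ω v
  refine ⟨s, hs, fun t _ hst => ?_⟩
  rintro _ ⟨p, ⟨hp, t', ht', htt', hpt'⟩, rfl⟩
  have := hb p hp.1 t' ht' hpt'
  linarith

lemma reflect_cap_subset (Ω : Domain M n) (v : Direction n) {t : ℝ} (ht : t ∈ interval M)
    (hm : criticalValue Ω.region v < t) :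
    reflect M v t '' capOf (frontier Ω.region) v t ⊆ Ω.region := by
  obtain ⟨s, hs, hst⟩ := exists_lt_of_csInf_lt (critical_set_nonempty Ω v) hm
  exact hs.2 t ht hst

lemma mem_interval_of_between {s t u : ℝ} (hs : s ∈ interval M) (hu : u ∈ interval M)
    (h1 : s ≤ t) (h2 : t ≤ u) : t ∈ interval M := by
  cases M with
  | euclidean => trivial
  | hyperbolic => trivial
  | spherical => exact ⟨hs.1.trans_le h1, h2.trans_lt hu.2⟩

lemma mem_interval_of_critical_lt (Ω : Domain M n) (v : Direction n) {t u : ℝ}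
    (h1 : criticalValue Ω.region v < t) (hu : u ∈ interval M) (h2 : t ≤ u) : t ∈ interval M := by
  obtain ⟨s, hs, hst⟩ := exists_lt_of_csInf_lt (critical_set_nonempty Ω v) h1
  exact mem_interval_of_between hs.1 hu hst.le h2

/-- Sliding a point of a domain away from the hyperplanes `π_{v,s}` one arrives at the frontier. -/
lemma exists_slide_mem_frontier (Ω : Domain M n) {v : Direction n} {p : Point M n} {t a : ℝ}
    {w : EuclideanSpace ℝ (Fin n)} (hp : p ∈ Ω.region) (h : Splits v p t a w)
    (ht : t ∈ interval M) :
    ∃ s ∈ interval M, t ≤ s ∧ ∃ q ∈ frontier Ω.region, Splits v q s a w := by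
  set c : ℝ → Point M n := fun s => reflect M v ((s + t) / 2) p with hc
  have hcont : Continuous c := (continuous_reflect v p).comp (by fun_prop)
  have hct : c t = p := (h.slide t).unique h
  obtain ⟨s₁, hts₁, hs₁, hsph⟩ : ∃ s₁, t ≤ s₁ ∧ c s₁ ∉ Ω.region ∧
      (M = spherical → s₁ = Real.pi / 2) := by
    by_cases hM : M = spherical
    · subst hM
      refine ⟨Real.pi / 2, ht.2.le, fun hmem => ?_, fun _ => rfl⟩
      have h1 : 0 < (c (Real.pi / 2)).val.fst := Ω.closure_subset (subset_closure hmem)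
      rw [(h.slide (Real.pi / 2)).fst, cn, Real.cos_pi_div_two, mul_zero] at h1
      exact lt_irrefl _ h1
    · obtain ⟨q, -, hmax⟩ := Ω.isCompact_closure.exists_isMaxOn
        Ω.isConnected.nonempty.closure (f := fun x => dist p x) (by fun_prop)
      set D := dist p q
      have hD : 0 ≤ D := dist_nonneg
      refine ⟨t + D + 1, by linarith, fun hmem => ?_, fun h => absurd h hM⟩
      have hle : dist p (c (t + D + 1)) ≤ D := hmax (subset_closure hmem)
      have hsl := h.slide (t + D + 1)
      refine absurd hle (not_le.2 ?_)
      cases M with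
      | euclidean =>
        rw [h.dist_euclidean hsl, show t - (t + D + 1) = -(D + 1) by ring, abs_neg,
          abs_of_pos (by linarith)]
        linarith
      | hyperbolic =>
        have h1 := h.cosh_dist hsl
        rw [real_inner_self_eq_norm_sq, show t - (t + D + 1) = -(D + 1) by ring,
          Real.cosh_neg] at h1
        have h2 : Real.cosh (D + 1) ≤ Real.cosh (dist p (c (t + D + 1))) := by
          rw [h1]
          nlinarith [h.sq_hyperbolic, sq_nonneg ‖w‖, Real.one_le_cosh (D + 1)]
        rw [Real.cosh_le_cosh, abs_of_nonneg (by linarith : 0 ≤ D + 1),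
          abs_of_nonneg dist_nonneg] at h2
        linarith
      | spherical => exact absurd rfl hM
  obtain ⟨_, ⟨s, hs, rfl⟩, hf⟩ := exists_mem_frontier_of_isPreconnected
    (isPreconnected_Icc.image c hcont.continuousOn) ⟨t, ⟨le_rfl, hts₁⟩, rfl⟩ (hct.symm ▸ hp)
    ⟨s₁, ⟨hts₁, le_rfl⟩, rfl⟩ hs₁
  refine ⟨s, ?_, hs.1, c s, hf, h.slide s⟩
  cases M with
  | euclidean => trivial
  | hyperbolic => trivial
  | spherical =>
    refine ⟨ht.1.trans_le hs.1, lt_of_le_of_ne (hsph rfl ▸ hs.2) ?_⟩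
    rintro rfl
    have h1 : 0 < (c (Real.pi / 2)).val.fst := Ω.closure_subset hf.1
    rw [(h.slide (Real.pi / 2)).fst, cn, Real.cos_pi_div_two, mul_zero] at h1
    exact lt_irrefl _ h1

/-- Beyond the critical position the reflection of the whole cap, not only of its frontier part,
is inside the domain: the reflection of an interior point `p` about `π_{v,t}` is also the
reflection, about a hyperplane further out, of the frontier point reached by sliding `p`. -/
lemma reflect_mem_region (Ω : Domain M n) (v : Direction n) {p : Point M n} (hp : p ∈ Ω.region)
    {t t₀ : ℝ} (ht₀ : t₀ ∈ interval M) (hpt : p ∈ hyperplane M v t₀)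
    (hm : criticalValue Ω.region v < t) (htt : t < t₀) : reflect M v t p ∈ Ω.region := by
  have ht := mem_interval_of_critical_lt Ω v hm ht₀ htt.le
  obtain ⟨a, w, h⟩ :=
    exists_splits_of_mem_hyperplane (Ω.closure_subset (subset_closure hp)) ht₀ hpt
  obtain ⟨s, hs, hts, q, hq, hsq⟩ := exists_slide_mem_frontier Ω hp h ht₀
  set u := t + (s - t₀) / 2 with hu
  have hu' : u ∈ interval M := mem_interval_of_between ht hs (by linarith) (by linarith)
  have h1 := reflect_cap_subset Ω v hu' (by linarith)
    ⟨q, ⟨hq, s, hs, by linarith, hsq.mem_hyperplane⟩, rfl⟩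
  have h2 := hsq.reflect u
  rw [show 2 * u - s = 2 * t - t₀ by rw [hu]; ring] at h2
  rwa [(h.reflect t).unique h2]

lemma reflect_maximalCap_mem_closure (Ω : Domain M n) (v : Direction n) {p : Point M n}
    (hp : p ∈ maximalCap Ω.region v) :
    reflect M v (criticalValue Ω.region v) p ∈ closure Ω.region := by
  obtain ⟨hpΩ, t₀, ht₀, hm, hpt⟩ := hp
  refine mem_closure_of_tendsto (f := fun t => reflect M v t p)
    (b := 𝓝[>] (criticalValue Ω.region v))
    ((continuous_reflect v p).continuousWithinAt) ?_
  filter_upwards [Ioo_mem_nhdsGT hm] with t ht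
  exact reflect_mem_region Ω v hpΩ ht₀ hpt ht.1 ht.2

/-- Approximate symmetry makes the domain almost invariant, in the Hausdorff distance, under the
reflection about every critical hyperplane. -/
lemma ApproxSymmetric.infDist_reflect_le {deficit : DeficitFunction M n} {Ω : Domain M n} {K : ℝ}
    (h : ApproxSymmetric deficit Ω K) (v : Direction n) {p : Point M n} (hp : p ∈ Ω.region) :
    Metric.infDist (reflect M v (criticalValue Ω.region v) p) Ω.region ≤ K * deficit.toFun Ω := by
  obtain ⟨x, hx, hx'⟩ := h v
  set m := criticalValue Ω.region v
  set T := connectedComponentIn (maximalCap Ω.region v) x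
  have hsub : T ⊆ maximalCap Ω.region v := connectedComponentIn_subset _ _
  refine le_of_forall_gt_imp_ge_of_dense fun ε hε => ?_
  obtain ⟨q, hq, hpq⟩ := (Metric.infDist_lt_iff
    ⟨x, Or.inl (mem_connectedComponentIn hx)⟩).1 ((hx' p hp).trans_lt hε)
  have hq' : reflect M v m q ∈ closure Ω.region := by
    rcases hq with hq | ⟨y, hy, rfl⟩
    · exact reflect_maximalCap_mem_closure Ω v (hsub hq)
    · rw [reflect_reflect]
      exact subset_closure (hsub hy).1
  rw [← Metric.infDist_closure]
  refine (Metric.infDist_le_dist_of_mem hq').trans ?_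
  rw [dist_reflect]
  exact hpq.le

/-! ### The centre of mass -/

lemma isFiniteMeasureOnCompacts (hn : n ≠ 0) :
    MeasureTheory.IsFiniteMeasureOnCompacts (μHE[n] : MeasureTheory.Measure (Point M n)) where
  lt_top_of_isCompact _ hK := hK.measure_lt_top_of_nhdsWithin fun x _ =>
    ⟨Metric.ball x (1 / 10), mem_nhdsWithin_of_mem_nhds (Metric.ball_mem_nhds x (by norm_num)),
      (measure_ball_le hn x (by norm_num) le_rfl).trans_lt ENNReal.ofReal_lt_top⟩

lemma measure_region_lt_top (hn : n ≠ 0) (Ω : Domain M n) : μHE[n] Ω.region < ⊤ :=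
  have := isFiniteMeasureOnCompacts (M := M) hn
  (MeasureTheory.measure_mono subset_closure).trans_lt Ω.isCompact_closure.measure_lt_top

lemma integrableOn_region (hn : n ≠ 0) (Ω : Domain M n) {E : Type*} [NormedAddCommGroup E]
    {f : Point M n → E} (hf : Continuous f) :
    MeasureTheory.IntegrableOn f Ω.region μHE[n] :=
  have := isFiniteMeasureOnCompacts (M := M) hn
  (hf.continuousOn.integrableOn_compact Ω.isCompact_closure).mono_set subset_closure

lemma continuous_height (v : Direction n) (s : ℝ) :
    Continuous fun p : Point M n => height v s p :=
  (continuous_form M).comp ((continuous_val.sub continuous_const).prodMk continuous_const)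

/-- Only the points whose reflection leaves the set contribute to the mean height over a
hyperplane. -/
lemma abs_integral_height_le (hn : n ≠ 0) (Ω : Domain M n) (v : Direction n) (s : ℝ) {H W : ℝ}
    (hH0 : 0 ≤ H) (hW0 : 0 ≤ W) (hH : ∀ x ∈ Ω.region, |height v s x| ≤ H)
    (hW : μHE[n] {x ∈ Ω.region | reflect M v s x ∉ Ω.region} ≤ ENNReal.ofReal W) :
    |∫ x in Ω.region, height v s x ∂μHE[n]| ≤ H * W := by
  set g := reflectEquiv M v s
  set B := g ⁻¹' Ω.region with hB
  have hg : ∀ x, g (g x) = x := reflect_reflect v s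
  have hBm : MeasurableSet B := (Ω.isOpen.preimage g.continuous).measurableSet
  have hΩm := Ω.isOpen.measurableSet
  have h0 : ∫ x in Ω.region ∩ B, height v s x ∂μHE[n] = 0 := by
    have hpre : g ⁻¹' (Ω.region ∩ B) = Ω.region ∩ B := by
      ext x
      simp only [hB, Set.mem_preimage, Set.mem_inter_iff, hg, and_comm]
    have h1 := (g.measurePreserving_euclideanHausdorffMeasure n).setIntegral_preimage_emb
      g.toHomeomorph.measurableEmbedding (fun x => height v s x) (Ω.region ∩ B)
    rw [hpre] at h1
    have h2 : ∀ x, height v s (g x) = -height v s x := height_reflect v s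
    simp only [h2, MeasureTheory.integral_neg] at h1
    linarith
  have h1 := MeasureTheory.integral_inter_add_sdiff hBm
    (integrableOn_region hn Ω (continuous_height (M := M) v s))
  rw [h0, zero_add] at h1
  rw [← h1]
  have hfin : μHE[n] (Ω.region \ B) < ⊤ :=
    (MeasureTheory.measure_mono Set.sdiff_subset).trans_lt (measure_region_lt_top hn Ω)
  refine (MeasureTheory.norm_setIntegral_le_of_norm_le_const (f := fun x => height v s x) hfin
    fun x hx => hH x hx.1).trans ?_
  refine mul_le_mul_of_nonneg_left ?_ hH0
  exact ENNReal.toReal_le_of_le_ofReal hW0 hW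

/-- An almost invariant domain with touching balls is almost invariant in measure. -/
lemma measure_not_reflect_le (hn : n ≠ 0) {Ω : Domain M n} {ρ A ε : ℝ} (hT : TouchingBall Ω ρ)
    (hA : 0 ≤ A) (hΩA : Ω.area ≤ ENNReal.ofReal A) (hε0 : 0 < ε) (hε : ε ≤ 1 / 380)
    (hερ : ε ≤ ρ) {v : Direction n} {s : ℝ}
    (h : ∀ x ∈ Ω.region, Metric.infDist (reflect M v s x) Ω.region ≤ ε) :
    μHE[n] {x ∈ Ω.region | reflect M v s x ∉ Ω.region} ≤
      ENNReal.ofReal (A * 570 ^ n * 15 ^ (n - 1) * unitBallVolume n /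
        unitBallVolume (n - 1) * ε) := by
  rw [← (reflectEquiv M v s).isometry.euclideanHausdorffMeasure_image]
  refine (MeasureTheory.measure_mono ?_).trans (measure_neighborhood_le hn isClosed_frontier hA
    hΩA hε0 hε fun p hp => hT.le_measure_frontier hn hε0 (by linarith) hερ hp)
  rintro _ ⟨x, ⟨hx, hx'⟩, rfl⟩
  obtain ⟨y, hy, hxy⟩ := Ω.isCompact_closure.exists_infDist_eq_dist Ω.isConnected.nonempty.closure
    (reflect M v s x)
  obtain ⟨z, hz, hxz⟩ := exists_frontier_of_dist hn hx' hy
  refine ⟨z, hz, hxz.trans ?_⟩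
  rw [← hxy, Metric.infDist_closure]
  exact h x hx

lemma form_self_eq (hM : M ≠ euclidean) (p q : Point M n) :
    form M p.val p.val = form M q.val q.val := by
  cases M with
  | euclidean => exact absurd rfl hM
  | hyperbolic => exact p.mem.1.trans q.mem.1.symm
  | spherical => exact Eq.trans (b := (1 : ℝ)) p.mem (Eq.symm q.mem)

lemma form_reflect_self (hM : M ≠ euclidean) (v : Direction n) (s : ℝ) (p : Point M n) :
    form M p.val (reflect M v s p).val = form M p.val p.val - 2 * height v s p ^ 2 := by
  rw [reflect_val, form_sub_right, form_smul_right, height_of_ne_euclidean hM]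
  ring

lemma abs_height_le (v : Direction n) (s : ℝ) (p : Point M n) {D : ℝ}
    (hD : dist p (reflect M v s p) ≤ D) : |height v s p| ≤ Real.cosh D := by
  have h1 := Real.one_le_cosh D
  have hd := dist_nonneg (x := p) (y := reflect M v s p)
  have hcosh : Real.cosh (dist p (reflect M v s p)) ≤ Real.cosh D := by
    rw [Real.cosh_le_cosh, abs_of_nonneg hd]
    exact hD.trans (le_abs_self D)
  have hsq := sq_div_two_le_cosh_sub_one hd
  refine abs_le_of_sq_le_sq ?_ (by linarith)
  cases M with
  | euclidean =>
    have h2 : dist p (reflect euclidean v s p) = 2 * |height v s p| := by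
      rw [dist_euclidean, reflect_val, WithLp.sub_snd, WithLp.smul_snd, velocity_snd,
        sub_sub_cancel, cn, one_smul, norm_smul, norm_direction, mul_one, Real.norm_eq_abs,
        abs_mul, abs_two]
    rw [h2] at hcosh
    rw [h2, mul_pow, sq_abs] at hsq
    nlinarith
  | hyperbolic =>
    have h2 := form_reflect_self (by simp) v s p
    rw [p.mem.1] at h2
    have h3 := cosh_dist p (reflect hyperbolic v s p)
    nlinarith
  | spherical =>
    have h2 := form_reflect_self (by simp) v s p
    have h4 : form spherical p.val p.val = 1 := p.mem
    have h3 := cos_dist p (reflect spherical v s p)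
    have := Real.neg_one_le_cos (dist p (reflect spherical v s p))
    nlinarith

/-- The form against a fixed vector, as a continuous linear functional. -/
noncomputable def formRight (M : SpaceForm) (y : Ambient n) : Ambient n →L[ℝ] ℝ :=
  LinearMap.toContinuousLinearMap
    { toFun := fun x => form M x y
      map_add' := fun x x' => form_add_left M x x' y
      map_smul' := fun c x => form_smul_left M c x y }

/-- The vector `∫_Ω x` of the linear space in which the space form is realised. -/
noncomputable def moment (Ω : Domain M n) : Ambient n := ∫ x in Ω.region, x.val ∂μHE[n]

lemma form_moment (hn : n ≠ 0) (Ω : Domain M n) (y : Ambient n) :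
    form M (moment Ω) y = ∫ x in Ω.region, form M x.val y ∂μHE[n] :=
  ((formRight M y).integral_comp_comm (integrableOn_region hn Ω continuous_val)).symm

lemma fst_moment (hn : n ≠ 0) (Ω : Domain M n) :
    (moment Ω).fst = ∫ x in Ω.region, x.val.fst ∂μHE[n] :=
  ((WithLp.fstL 2 ℝ ℝ (EuclideanSpace ℝ (Fin n))).integral_comp_comm
    (integrableOn_region hn Ω continuous_val)).symm

lemma le_integral_of_ball (hn : n ≠ 0) (Ω : Domain M n) {c : Point M n} {r k : ℝ} (hr0 : 0 < r)
    (hr : r ≤ 1) (hk : 0 ≤ k) (hball : Metric.ball c r ⊆ Ω.region) {f : Point M n → ℝ}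
    (hf : Continuous f) (hf0 : ∀ x ∈ Ω.region, 0 ≤ f x) (hfk : ∀ x ∈ Metric.ball c r, k ≤ f x) :
    k * ((r / 15) ^ n * unitBallVolume n) ≤ ∫ x in Ω.region, f x ∂μHE[n] := by
  have hint := integrableOn_region hn Ω hf
  have hfin : μHE[n] (Metric.ball c r) ≠ ⊤ :=
    ((MeasureTheory.measure_mono hball).trans_lt (measure_region_lt_top hn Ω)).ne
  calc k * ((r / 15) ^ n * unitBallVolume n)
      ≤ k * (μHE[n] (Metric.ball c r)).toReal :=
        mul_le_mul_of_nonneg_left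
          ((ENNReal.ofReal_le_iff_le_toReal hfin).1 (le_measure_ball hn c hr0 hr)) hk
    _ ≤ ∫ x in Metric.ball c r, f x ∂μHE[n] :=
        MeasureTheory.setIntegral_ge_of_const_le_real Metric.isOpen_ball.measurableSet hfin hfk
          (hint.mono_set hball)
    _ ≤ _ := by
        refine MeasureTheory.setIntegral_mono_set hint ?_ (MeasureTheory.ae_of_all _ hball)
        exact (MeasureTheory.ae_restrict_iff' Ω.isOpen.measurableSet).2
          (MeasureTheory.ae_of_all _ hf0)

/-- The half ball of a ball inside the open hemisphere keeps away from the equator. -/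
lemma sin_le_fst_of_ball {c x : Point spherical n} (hn : n ≠ 0) {r : ℝ} (hr0 : 0 < r)
    (hball : Metric.ball c r ⊆ plus spherical n) (hx : dist x c < r / 2) :
    Real.sin (r / 2) ≤ x.val.fst := by
  by_contra! hc
  have hpi := Real.pi_gt_three
  set o := origin spherical n
  have h1 : Real.pi / 2 - r / 2 < dist o x := by
    by_contra! h
    have := Real.cos_le_cos_of_nonneg_of_le_pi dist_nonneg (by linarith) h
    rw [Real.cos_pi_div_two_sub, cos_dist_origin] at this
    linarith
  have h2 : Real.pi / 2 - r < dist o c := by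
    have := dist_triangle o c x
    rw [dist_comm c x] at this
    linarith
  have h3 : dist o c < Real.pi / 2 := by
    by_contra! h
    have h4 : 0 < c.val.fst := hball (Metric.mem_ball_self hr0)
    rw [← cos_dist_origin] at h4
    exact h4.not_ge (Real.cos_nonpos_of_pi_div_two_le_of_le h
      (by linarith [dist_le_pi o c]))
  obtain ⟨y, hy, hyc⟩ := exists_dist_eq hn o c (τ := Real.pi / 2)
    ⟨by linarith, fun _ => by linarith⟩
  have h5 : 0 < y.val.fst := hball (by
    rw [Metric.mem_ball, hyc, abs_of_pos (by linarith)]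
    linarith)
  rw [← cos_dist_origin, hy, Real.cos_pi_div_two] at h5
  exact lt_irrefl _ h5

/-- The weight of the centre of mass in `exists_center`, for an inscribed ball of radius `r`. -/
noncomputable def centerWeight (n : ℕ) (r : ℝ) : ℝ :=
  Real.sin (r / 2) * ((r / 2 / 15) ^ n * unitBallVolume n)

lemma centerWeight_pos {r : ℝ} (hr0 : 0 < r) (hr : r ≤ 1) : 0 < centerWeight n r :=
  mul_pos (Real.sin_pos_of_pos_of_lt_pi (by linarith) (by linarith [Real.pi_gt_three]))
    (mul_pos (by positivity) (unitBallVolume_pos n))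

lemma centerWeight_le_volume (hn : n ≠ 0) (Ω : Domain M n) {c : Point M n} {r : ℝ}
    (hr0 : 0 < r) (hr : r ≤ 1) (hball : Metric.ball c r ⊆ Ω.region) :
    centerWeight n r ≤ (μHE[n] Ω.region).toReal := by
  have h := le_integral_of_ball hn Ω (half_pos hr0) (by linarith) zero_le_one
    ((Metric.ball_subset_ball (by linarith)).trans hball) (f := fun _ => 1) continuous_const
    (fun _ _ => zero_le_one) fun _ _ => le_rfl
  rw [MeasureTheory.setIntegral_const, smul_eq_mul, mul_one] at h
  refine le_trans (mul_le_mul_of_nonneg_right (Real.sin_le_one _) ?_) h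
  have := unitBallVolume_pos n
  positivity

lemma mul_form_inv_smul {b : ℝ} (hb : b ≠ 0) (x y : Ambient n) :
    b * form M (b⁻¹ • x) y = form M x y := by
  rw [form_smul_left, mul_inv_cancel_left₀ hb]

/-- The centre of mass: the projection to the space form of the vector `∫_Ω x`. Since heights over
hyperplanes are linear, their means over the domain are multiples of the heights of the centre.
In the spherical case the multiple is only bounded below after weighting with the distance of
the centre to the equator. -/
lemma exists_center (hn : n ≠ 0) (Ω : Domain M n) {c : Point M n} {r L : ℝ} (hr0 : 0 < r)
    (hr : r ≤ 1) (hball : Metric.ball c r ⊆ Ω.region)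
    (hL : ∀ x ∈ Ω.region, ∀ y ∈ Ω.region, dist x y ≤ L) :
    ∃ O ∈ plus M n, ∃ β : ℝ, 0 < β ∧
      (∀ v s, ∫ x in Ω.region, height v s x ∂μHE[n] = β * height v s O) ∧
      (M ≠ spherical → centerWeight n r ≤ β ∧ ∀ x ∈ Ω.region, dist O x ≤ L) ∧
      (M = spherical → centerWeight n r ≤ β * O.val.fst) := by
  set V := (μHE[n] Ω.region).toReal with hV
  have hw := centerWeight_pos (n := n) hr0 hr
  have hwV : centerWeight n r ≤ V := centerWeight_le_volume hn Ω hr0 hr hball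
  have hV0 : 0 < V := hw.trans_le hwV
  have hconst : ∀ k : ℝ, ∫ _ in Ω.region, k ∂μHE[n] = V * k := fun k => by
    rw [MeasureTheory.setIntegral_const, smul_eq_mul]; rfl
  have hΩm := Ω.isOpen.measurableSet
  set b := moment Ω with hb
  have hint : ∀ y : Ambient n, MeasureTheory.IntegrableOn (fun x : Point M n => form M x.val y)
      Ω.region μHE[n] := fun y => integrableOn_region hn Ω
    ((continuous_form M).comp (continuous_val.prodMk continuous_const))
  cases M with
  | euclidean =>
    have hbf : b.fst = V := by
      rw [hb, fst_moment hn]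
      simp only [fst_euclidean]
      rw [hconst, mul_one]
    refine ⟨⟨V⁻¹ • b, ?_⟩, ?_, V, hV0, fun v s => ?_, fun _ => ⟨hwV, fun x hx => ?_⟩,
      fun h => by simp at h⟩
    · change (V⁻¹ • b).fst = 1
      rw [WithLp.smul_fst, hbf, smul_eq_mul, inv_mul_cancel₀ hV0.ne']
    · exact fst_pos_of_ne_spherical (by simp) _
    · simp only [height, form_sub_left]
      rw [MeasureTheory.integral_sub (hint _) (integrableOn_region hn Ω continuous_const), hconst,
        ← form_moment hn, mul_sub, mul_form_inv_smul hV0.ne']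
    · set z : EuclideanSpace ℝ (Fin n) := (V⁻¹ • b).snd - x.val.snd with hz
      change ‖z‖ ≤ L
      have h1 : V * ‖z‖ ^ 2 = ∫ y in Ω.region, inner ℝ (y.val.snd - x.val.snd) z ∂μHE[n] := by
        have h2 := form_moment hn Ω (WithLp.toLp 2 (0, z))
        change inner ℝ b.snd z = ∫ y in Ω.region, inner ℝ y.val.snd z ∂μHE[n] at h2
        simp only [inner_sub_left]
        have h3 : MeasureTheory.IntegrableOn (fun y : Point euclidean n => inner ℝ y.val.snd z)
          Ω.region μHE[n] := hint (WithLp.toLp 2 (0, z))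
        rw [MeasureTheory.integral_sub h3
          (integrableOn_region hn Ω continuous_const), hconst, ← h2,
          ← real_inner_self_eq_norm_sq]
        have h4 : inner ℝ z z = inner ℝ (V⁻¹ • b).snd z - inner ℝ x.val.snd z := by
          rw [← inner_sub_left]
        rw [h4, WithLp.smul_snd, real_inner_smul_left, mul_sub, mul_inv_cancel_left₀ hV0.ne']
      have h2 : V * ‖z‖ ^ 2 ≤ V * (L * ‖z‖) := by
        rw [h1, ← hconst]
        refine MeasureTheory.setIntegral_mono_on (integrableOn_region hn Ω
          ((continuous_snd.sub continuous_const).inner continuous_const))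
          (integrableOn_region hn Ω continuous_const) hΩm fun y hy => ?_
        refine (real_inner_le_norm _ _).trans ?_
        exact mul_le_mul_of_nonneg_right (hL y hy x hx) (norm_nonneg _)
      have h3 := le_of_mul_le_mul_left h2 hV0
      by_contra! hlt
      have hz0 : 0 ≤ L := dist_nonneg.trans (hL x hx x hx)
      nlinarith
  | hyperbolic =>
    have hform : ∀ p : Point hyperbolic n, form hyperbolic b p.val ≤ -V := fun p => by
      rw [hb, form_moment hn]
      have h1 : ∫ x in Ω.region, form hyperbolic x.val p.val ∂μHE[n] ≤
          ∫ _ in Ω.region, (-1 : ℝ) ∂μHE[n] :=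
        MeasureTheory.setIntegral_mono_on (hint _) (integrableOn_region hn Ω continuous_const) hΩm
          fun x _ => by linarith [one_le_lorentz _ _ x.mem p.mem]
      rw [hconst] at h1
      linarith
    have hbf : 0 < b.fst := by
      have h1 := hform (origin hyperbolic n)
      rw [form, origin_fst, origin_snd, inner_zero_right] at h1
      linarith
    have hbb : V * V ≤ -form hyperbolic b b := by
      have h1 : form hyperbolic b b ≤ ∫ _ in Ω.region, (-V) ∂μHE[n] := by
        conv_lhs => rw [hb, form_moment hn]
        exact MeasureTheory.setIntegral_mono_on (hint _)
          (integrableOn_region hn Ω continuous_const) hΩm fun x _ => by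
            rw [form_comm]; exact hform x
      rw [hconst] at h1
      linarith
    set β := √(-form hyperbolic b b) with hβ
    have hβ2 : β ^ 2 = -form hyperbolic b b := Real.sq_sqrt (by nlinarith)
    have hβV : V ≤ β := Real.le_sqrt_of_sq_le (by rw [sq]; exact hbb)
    have hβ0 : 0 < β := hV0.trans_le hβV
    have hmem : β⁻¹ • b ∈ carrier hyperbolic := by
      refine ⟨?_, ?_⟩
      · rw [form_smul_left, form_smul_right, show form hyperbolic b b = -β ^ 2 by linarith]
        field_simp
      · rw [WithLp.smul_fst, smul_eq_mul]
        positivity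
    refine ⟨⟨β⁻¹ • b, hmem⟩, hmem.2, β, hβ0, fun v s => ?_,
      fun _ => ⟨hwV.trans hβV, fun x hx => ?_⟩,
      fun h => by simp at h⟩
    · simp only [height_of_ne_euclidean (M := hyperbolic) (by simp)]
      rw [mul_form_inv_smul hβ0.ne', form_moment hn]
    · have hL0 : 0 ≤ L := dist_nonneg.trans (hL x hx x hx)
      have h1 : V * (-Real.cosh L) ≤ form hyperbolic b x.val := by
        rw [hb, form_moment hn, ← hconst]
        refine MeasureTheory.setIntegral_mono_on (integrableOn_region hn Ω continuous_const)
          (hint _) hΩm fun y hy => ?_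
        have h2 := cosh_dist y x
        have h3 : Real.cosh (dist y x) ≤ Real.cosh L := by
          rw [Real.cosh_le_cosh, abs_of_nonneg dist_nonneg, abs_of_nonneg hL0]
          exact hL y hy x hx
        linarith
      have h2 := cosh_dist (⟨β⁻¹ • b, hmem⟩ : Point hyperbolic n) x
      have h3 := mul_form_inv_smul (M := hyperbolic) hβ0.ne' b x.val
      have h4 : β * Real.cosh (dist (⟨β⁻¹ • b, hmem⟩ : Point hyperbolic n) x) ≤
          β * Real.cosh L := by
        rw [h2]
        nlinarith [Real.cosh_pos L]
      have h5 := le_of_mul_le_mul_left h4 hβ0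
      rwa [Real.cosh_le_cosh, abs_of_nonneg dist_nonneg, abs_of_nonneg hL0] at h5
  | spherical =>
    have hbf : centerWeight n r ≤ b.fst := by
      rw [hb, fst_moment hn]
      exact le_integral_of_ball hn Ω (half_pos hr0) (by linarith)
        (Real.sin_nonneg_of_nonneg_of_le_pi (by linarith) (by linarith [Real.pi_gt_three]))
        ((Metric.ball_subset_ball (by linarith)).trans hball) continuous_fst
        (fun x hx => (Ω.closure_subset (subset_closure hx)).le) fun x hx =>
        sin_le_fst_of_ball hn hr0
          (hball.trans (subset_closure.trans Ω.closure_subset)) hx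
    have hbb : 0 < form spherical b b := by
      simp only [form, real_inner_self_eq_norm_sq]
      nlinarith [sq_nonneg ‖b.snd‖]
    set β := √(form spherical b b) with hβ
    have hβ2 : β ^ 2 = form spherical b b := Real.sq_sqrt hbb.le
    have hβ0 : 0 < β := Real.sqrt_pos.2 hbb
    have hmem : β⁻¹ • b ∈ carrier spherical := by
      change form spherical _ _ = 1
      rw [form_smul_left, form_smul_right, ← hβ2]
      field_simp
    refine ⟨⟨β⁻¹ • b, hmem⟩, ?_, β, hβ0, fun v s => ?_, fun h => absurd rfl h, fun _ => ?_⟩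
    · change 0 < (β⁻¹ • b).fst
      rw [WithLp.smul_fst, smul_eq_mul]
      exact mul_pos (inv_pos.2 hβ0) (hw.trans_le hbf)
    · simp only [height_of_ne_euclidean (M := spherical) (by simp)]
      rw [mul_form_inv_smul hβ0.ne', form_moment hn]
    · rw [WithLp.smul_fst, smul_eq_mul, mul_inv_cancel_left₀ hβ0.ne']
      exact hbf

/-! ### Reflections through the centre -/

/-- Two points at the same distance from `O` are exchanged by the reflection about one of the
hyperplanes `π_{v,s}` through `O`. -/
lemma exists_reflect_eq {O x y : Point M n} (hO : O ∈ plus M n) (hxy : x ≠ y)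
    (hd : dist O x = dist O y) :
    ∃ v : Direction n, ∃ s a w, Splits v O s a w ∧ s ∈ interval M ∧ reflect M v s x = y := by
  have hOf : 0 < O.val.fst := hO
  have hform : M ≠ euclidean → form M (x.val - y.val) O.val = 0 := by
    intro hM
    rw [form_sub_left, form_comm M x.val, form_comm M y.val]
    cases M with
    | euclidean => exact absurd rfl hM
    | hyperbolic => linarith [cosh_dist O x, cosh_dist O y, congrArg Real.cosh hd]
    | spherical => linarith [cos_dist O x, cos_dist O y, congrArg Real.cos hd]
  have hne : x.val.snd - y.val.snd ≠ 0 := by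
    intro h0
    refine hxy (Point.ext (ambient_ext ?_ (sub_eq_zero.1 h0)))
    cases M with
    | euclidean => rw [fst_euclidean, fst_euclidean]
    | hyperbolic =>
      have h1 := hform (by simp)
      rw [form, WithLp.sub_snd, h0, inner_zero_left, WithLp.sub_fst] at h1
      have h2 : (x.val.fst - y.val.fst) * O.val.fst = 0 := by linarith
      exact sub_eq_zero.1 ((mul_eq_zero.1 h2).resolve_right hOf.ne')
    | spherical =>
      have h1 := hform (by simp)
      rw [form, WithLp.sub_snd, h0, inner_zero_left, WithLp.sub_fst, zero_add] at h1
      exact sub_eq_zero.1 ((mul_eq_zero.1 h1).resolve_right hOf.ne')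
  set κ := ‖x.val.snd - y.val.snd‖ with hκ
  have hκ0 : 0 < κ := norm_pos_iff.2 hne
  obtain ⟨v, hsnd⟩ : ∃ v : Direction n, x.val.snd - y.val.snd = κ • v.1 :=
    ⟨⟨κ⁻¹ • (x.val.snd - y.val.snd), by
      rw [mem_sphere_zero_iff_norm, norm_smul, norm_inv, Real.norm_eq_abs, abs_of_pos hκ0,
        inv_mul_cancel₀ hκ0.ne']⟩, (smul_inv_smul₀ hκ0.ne' _).symm⟩
  have hvv : inner ℝ v.1 v.1 = (1 : ℝ) := by rw [real_inner_self_eq_norm_sq, norm_direction]; simp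
  obtain ⟨s, hs, a, w, h⟩ := exists_splits v hO
  refine ⟨v, s, a, w, h, hs, ?_⟩
  have hOv : inner ℝ O.val.snd v.1 = a * sn M s := by
    rw [h.snd, inner_add_left, real_inner_smul_left, hvv, h.orth]; ring
  -- the difference of the two points is a multiple of the normal of the hyperplane through `O`
  obtain ⟨l, hl0, hl⟩ : ∃ l : ℝ, l ≠ 0 ∧ x.val - y.val = l • velocity M v s := by
    have hc := cn_pos hs
    refine ⟨κ / cn M s, (div_pos hκ0 hc).ne', ambient_ext ?_ ?_⟩
    · rw [WithLp.sub_fst, WithLp.smul_fst, velocity_fst, smul_eq_mul]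
      cases M with
      | euclidean => simp [fst_euclidean, cnDeriv]
      | hyperbolic =>
        have h1 := hform (by simp)
        rw [form, WithLp.sub_snd, hsnd, real_inner_smul_left, real_inner_comm, hOv, WithLp.sub_fst,
          h.fst] at h1
        have h2 : a * (κ * sn hyperbolic s - (x.val.fst - y.val.fst) * cn hyperbolic s) = 0 := by
          linarith
        have h3 := (mul_eq_zero.1 h2).resolve_left h.pos.ne'
        rw [cnDeriv, div_mul_eq_mul_div, eq_div_iff hc.ne']
        change κ * Real.sinh s - _ = 0 at h3
        linarith
      | spherical =>
        have h1 := hform (by simp)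
        rw [form, WithLp.sub_snd, hsnd, real_inner_smul_left, real_inner_comm, hOv, WithLp.sub_fst,
          h.fst] at h1
        have h2 : a * (κ * sn spherical s + (x.val.fst - y.val.fst) * cn spherical s) = 0 := by
          linarith
        have h3 := (mul_eq_zero.1 h2).resolve_left h.pos.ne'
        rw [cnDeriv, div_mul_eq_mul_div, eq_div_iff hc.ne']
        change κ * Real.sin s + _ = 0 at h3
        linarith
    · rw [WithLp.sub_snd, WithLp.smul_snd, hsnd, velocity_snd, smul_smul,
        div_mul_cancel₀ _ hc.ne']
  have hheight : 2 * height v s x = l := by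
    by_cases hM : M = euclidean
    · subst hM
      have hl' : κ = l := by
        have h1 := congrArg (fun z : Ambient n => inner ℝ z.snd v.1) hl
        simp only [WithLp.sub_snd, WithLp.smul_snd, velocity_snd, cn, one_smul] at h1
        rwa [hsnd, real_inner_smul_left, real_inner_smul_left, hvv, mul_one, mul_one] at h1
      have h1 : y.val.snd - O.val.snd = (x.val.snd - O.val.snd) - κ • v.1 := by
        rw [← hsnd]; abel
      have h2 : ‖x.val.snd - O.val.snd‖ ^ 2 = ‖y.val.snd - O.val.snd‖ ^ 2 := by
        rw [← dist_euclidean, ← dist_euclidean, dist_comm x, dist_comm y, hd]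
      rw [h1, norm_sub_sq_real (x.val.snd - O.val.snd) (κ • v.1), norm_smul,
        norm_direction, Real.norm_eq_abs, abs_of_pos hκ0,
        real_inner_smul_right, inner_sub_left, hOv, h.eq_one rfl] at h2
      have h3 : height v s x = inner ℝ x.val.snd v.1 - s := by
        simp only [height, form, velocity_snd, geodesic_snd, WithLp.sub_snd, cn, sn, one_smul,
          inner_sub_left, real_inner_smul_left, hvv, mul_one]
      rw [h3, ← hl']
      simp only [sn, one_mul, mul_one] at h2
      have h4 : κ * (κ - 2 * (inner ℝ x.val.snd v.1 - s)) = 0 := by linarith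
      linarith [(mul_eq_zero.1 h4).resolve_left hκ0.ne']
    · rw [height_of_ne_euclidean hM]
      have h1 : form M (x.val - y.val) (x.val - y.val) = 2 * form M x.val (x.val - y.val) := by
        simp only [form_sub_left, form_sub_right, form_comm M y.val x.val]
        rw [form_self_eq hM y x]
        ring
      rw [hl, form_smul_left, form_smul_right, form_smul_right, form_velocity] at h1
      have h2 : l * (2 * form M x.val (velocity M v s) - l) = 0 := by linarith
      linarith [(mul_eq_zero.1 h2).resolve_left hl0]
  ext1
  rw [reflect_val, hheight, ← hl]
  abel

/-- Points near `O` are not much further from the geodesic `γ_v` than `O` itself. -/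
lemma Splits.le_mul_cosh {v : Direction n} {p q : Point hyperbolic n} {t s a b : ℝ}
    {w z : EuclideanSpace ℝ (Fin n)} (hp : Splits v p t a w) (hq : Splits v q s b z) :
    a ≤ 2 * b * Real.cosh (dist p q) := by
  have h1 := hp.cosh_dist hq
  have hw := hp.sq_hyperbolic
  have hz := hq.sq_hyperbolic
  have ha := hp.pos
  have hb := hq.pos
  have hwa : ‖w‖ ≤ a := abs_le_of_sq_le_sq' (by linarith) ha.le |>.2
  have hzb : ‖z‖ ≤ b := abs_le_of_sq_le_sq' (by linarith) hb.le |>.2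
  have h2 := real_inner_le_norm w z
  have h3 : a * (b - ‖z‖) ≤ Real.cosh (dist p q) := by
    rw [h1]
    have h4 := mul_le_mul_of_nonneg_left (Real.one_le_cosh (t - s)) (mul_pos ha hb).le
    have h5 := mul_le_mul_of_nonneg_right hwa (norm_nonneg z)
    linarith
  have h6 : a = (a * (b - ‖z‖)) * (b + ‖z‖) := by
    have : (b - ‖z‖) * (b + ‖z‖) = 1 := by ring_nf; linarith
    rw [mul_assoc, this, mul_one]
  have h7 := mul_le_mul_of_nonneg_right h3 (add_nonneg hb.le (norm_nonneg z))
  have h8 : 0 < Real.cosh (dist p q) := Real.cosh_pos _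
  nlinarith

/-- The reflections about `π_{v,s} ∋ O` and `π_{v,m}` move a point to places whose distance is
controlled by the height of `O` over `π_{v,m}`. -/
lemma dist_reflect_reflect_le {v : Direction n} {O x : Point M n} {s a : ℝ}
    {w : EuclideanSpace ℝ (Fin n)} (hO : Splits v O s a w) (hs : s ∈ interval M)
    (hx : x ∈ plus M n) (m : ℝ) {L β k e : ℝ} (hβ : 0 < β) (hk : 0 < k)
    (hL : M ≠ spherical → k ≤ β ∧ dist O x ≤ L) (hkO : M = spherical → k ≤ β * O.val.fst)
    (he : β * |height v m O| ≤ e) :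
    dist (reflect M v s x) (reflect M v m x) ≤ 4 * Real.cosh L * (e / k) := by
  obtain ⟨t, ht, b, z, h⟩ := exists_splits v hx
  have h1 := h.reflect s
  have h2 := h.reflect m
  have hcL := Real.one_le_cosh L
  have hh := hO.height m
  have he0 : 0 ≤ e := (mul_nonneg hβ.le (abs_nonneg _)).trans he
  have hek : 0 ≤ e / k := by positivity
  cases M with
  | euclidean =>
    rw [h1.dist_euclidean h2, show 2 * s - t - (2 * m - t) = 2 * (s - m) by ring, abs_mul, abs_two]
    rw [hO.eq_one rfl, one_mul] at hh
    rw [hh] at he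
    change β * |s - m| ≤ e at he
    have h3 : |s - m| ≤ e / k := by
      rw [le_div_iff₀ hk]
      nlinarith [(hL (by simp)).1, abs_nonneg (s - m)]
    nlinarith [abs_nonneg (s - m)]
  | hyperbolic =>
    set d := dist (reflect hyperbolic v s x) (reflect hyperbolic v m x) with hd
    have h3 := h1.cosh_dist h2
    rw [show 2 * s - t - (2 * m - t) = 2 * (s - m) by ring, real_inner_self_eq_norm_sq,
      Real.cosh_two_mul, Real.cosh_sq] at h3
    have h4 := h.sq_hyperbolic
    have h5 : Real.cosh d - 1 = 2 * (b * Real.sinh (s - m)) ^ 2 := by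
      rw [h3]
      have : ‖z‖ ^ 2 = b ^ 2 - 1 := by linarith
      rw [this]
      ring
    have h6 := sq_div_two_le_cosh_sub_one (dist_nonneg : 0 ≤ d)
    have h7 : d ≤ 2 * |b * Real.sinh (s - m)| := by
      refine abs_le_of_sq_le_sq' ?_ (by positivity) |>.2
      rw [mul_pow, sq_abs]
      linarith
    have h8 := h.le_mul_cosh hO
    have h9 : Real.cosh (dist x O) ≤ Real.cosh L := by
      have := (hL (by simp)).2
      rw [dist_comm] at this
      rw [Real.cosh_le_cosh, abs_of_nonneg dist_nonneg]
      exact this.trans (le_abs_self L)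
    have ha := hO.pos
    have hb := h.pos
    change height v m O = a * Real.sinh (s - m) at hh
    rw [hh, abs_mul, abs_of_pos ha] at he
    rw [abs_mul, abs_of_pos hb] at h7
    have h10 : a * |Real.sinh (s - m)| ≤ e / k := by
      rw [le_div_iff₀ hk]
      nlinarith [(hL (by simp)).1, mul_nonneg ha.le (abs_nonneg (Real.sinh (s - m)))]
    have h11 : b ≤ 2 * a * Real.cosh L := h8.trans (by gcongr)
    calc d ≤ 2 * (b * |Real.sinh (s - m)|) := h7
      _ ≤ 2 * ((2 * a * Real.cosh L) * |Real.sinh (s - m)|) := by gcongr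
      _ = 4 * Real.cosh L * (a * |Real.sinh (s - m)|) := by ring
      _ ≤ _ := by gcongr
  | spherical =>
    set d := dist (reflect spherical v s x) (reflect spherical v m x) with hd
    have h3 := h1.cos_dist h2
    rw [show 2 * s - t - (2 * m - t) = 2 * (s - m) by ring, real_inner_self_eq_norm_sq,
      Real.cos_two_mul, Real.cos_sq'] at h3
    have h4 := h.sq_spherical
    have hb1 : b ^ 2 ≤ 1 := by nlinarith [sq_nonneg ‖z‖]
    have h5 : 1 - Real.cos d ≤ 2 * Real.sin (s - m) ^ 2 := by
      rw [h3]
      have : ‖z‖ ^ 2 = 1 - b ^ 2 := by linarith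
      rw [this]
      nlinarith [sq_nonneg (Real.sin (s - m))]
    have h6 := Real.cos_le_one_sub_mul_cos_sq (x := d)
      (by rw [abs_of_nonneg dist_nonneg]; exact dist_le_pi _ _)
    have h7 : d ≤ Real.pi * |Real.sin (s - m)| := by
      refine abs_le_of_sq_le_sq' ?_ (by positivity) |>.2
      have h8 : 2 / Real.pi ^ 2 * d ^ 2 ≤ 2 * Real.sin (s - m) ^ 2 := by linarith
      rw [mul_pow, sq_abs]
      have := mul_le_mul_of_nonneg_right h8 (show 0 ≤ Real.pi ^ 2 / 2 by positivity)
      rw [show 2 / Real.pi ^ 2 * d ^ 2 * (Real.pi ^ 2 / 2) = d ^ 2 by field_simp] at this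
      linarith
    have ha := hO.pos
    change height v m O = a * Real.sin (s - m) at hh
    rw [hh, abs_mul, abs_of_pos ha] at he
    have hfa : O.val.fst ≤ a := by
      rw [hO.fst]
      exact mul_le_of_le_one_right ha.le (Real.cos_le_one s)
    have h10 : |Real.sin (s - m)| ≤ e / k := by
      rw [le_div_iff₀ hk]
      have := mul_le_mul_of_nonneg_left hfa hβ.le
      nlinarith [hkO rfl, abs_nonneg (Real.sin (s - m))]
    have hpi := Real.pi_le_four
    calc d ≤ Real.pi * |Real.sin (s - m)| := h7
      _ ≤ 4 * (e / k) := by gcongr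
      _ ≤ 4 * Real.cosh L * (e / k) := by nlinarith

/-! ### From almost rotational symmetry to annuli -/

lemma dist_lt_pi_of_mem_plus {O x : Point spherical n} (hO : O ∈ plus spherical n)
    (hx : x ∈ plus spherical n) : dist O x < Real.pi := by
  refine lt_of_le_of_ne (dist_le_pi O x) fun h => ?_
  have h1 := cos_dist O x
  rw [h, Real.cos_pi] at h1
  have hO1 : form spherical O.val O.val = 1 := O.mem
  have hx1 : form spherical x.val x.val = 1 := x.mem
  have h2 : form spherical (O.val + x.val) (O.val + x.val) = 0 := by
    simp only [form_add_left, form_add_right, form_comm spherical x.val O.val, hO1, hx1]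
    linarith
  simp only [form, real_inner_self_eq_norm_sq, WithLp.add_fst] at h2
  have h3 : 0 < O.val.fst + x.val.fst := add_pos hO hx
  nlinarith [sq_nonneg ‖(O.val + x.val).snd‖]

/-- If the set is almost invariant under rotations around `O`, an exterior touching ball centred
at `c` keeps it away from the sphere around `O` through `c`. -/
lemma le_abs_dist_sub_of_exterior (hn : n ≠ 0) {Ω : Set (Point M n)} {O c : Point M n} {ρ η : ℝ}
    (hΩ : Ω.Nonempty)
    (hsym : ∀ x ∈ Ω, ∀ y, dist O y = dist O x → Metric.infDist y Ω ≤ η)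
    (hc : Disjoint (Metric.ball c ρ) Ω) {x : Point M n} (hx : x ∈ closure Ω) :
    ρ - η ≤ |dist O x - dist O c| := by
  have hcl : IsClosed {x : Point M n | ρ - η ≤ |dist O x - dist O c|} :=
    isClosed_le continuous_const (by fun_prop)
  refine closure_minimal (fun x hx => ?_) hcl hx
  by_contra hlt
  simp only [Set.mem_ofPred_eq, not_le] at hlt
  obtain ⟨y, hy, hyc⟩ := exists_dist_eq hn O c (isRadius_dist O x)
  obtain ⟨z, hz, hyz⟩ := (Metric.infDist_lt_iff hΩ).1
    ((hsym x hx y hy).trans_lt (by linarith : η < ρ - |dist O x - dist O c|))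
  refine Set.disjoint_left.1 hc ?_ hz
  rw [Metric.mem_ball]
  have := dist_triangle_left z c y
  linarith

/-- A domain that is almost invariant under all rotations around `O` is pinched between two balls
around `O`. A frontier point has an exterior touching ball, so it is almost farthest from `O` or
almost nearest to `O` among all points of the domain; as the frontier is connected, and contains a
farthest point, the first alternative always holds. -/
lemma exists_balls_of_almost_symmetric (hn : n ≠ 0) {Ω : Domain M n} {O : Point M n}
    (hO : O ∈ plus M n) {ρ η : ℝ} (hT : TouchingBall Ω ρ) (hη0 : 0 ≤ η) (hη : η < ρ / 8)
    (hsym : ∀ x ∈ Ω.region, ∀ y, dist O y = dist O x → Metric.infDist y Ω.region ≤ η) :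
    ∃ r R : ℝ, 0 < r ∧ r ≤ R ∧ Metric.ball O r ⊆ Ω.region ∧ Ω.region ⊆ Metric.ball O R ∧
      R - r ≤ 2 * η := by
  have hpi : M = spherical → ∀ x ∈ Ω.region, dist O x < Real.pi := by
    rintro rfl x hx
    exact dist_lt_pi_of_mem_plus hO (Ω.closure_subset (subset_closure hx))
  obtain ⟨q₀, hq₀, hmax⟩ := exists_farthest hn Ω O hpi
  set R := dist O q₀ with hR
  have hcont : Continuous fun x : Point M n => dist O x := by fun_prop
  have halt : ∀ q ∈ frontier Ω.region,
      R - η ≤ dist O q ∨ ∀ x ∈ closure Ω.region, dist O q ≤ dist O x + η := by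
    intro q hq
    obtain ⟨-, c, hqc, hc⟩ := hT q hq
    have hfar : ∀ x ∈ closure Ω.region, ρ - η ≤ |dist O x - dist O c| := fun x hx =>
      le_abs_dist_sub_of_exterior hn Ω.isConnected.nonempty hsym hc hx
    have hqc' : |dist O q - dist O c| ≤ ρ := by
      rw [← hqc, dist_comm O q, dist_comm O c]
      exact abs_dist_sub_le q c O
    have hside : (∀ x ∈ closure Ω.region, dist O x ≤ dist O c) ∨
        ∀ x ∈ closure Ω.region, dist O c ≤ dist O x := by
      by_contra! hne
      obtain ⟨⟨x, hx, hxc⟩, y, hy, hyc⟩ := hne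
      obtain ⟨z, hz, hzc⟩ := Ω.isConnected.isPreconnected.closure.intermediate_value hy hx
        hcont.continuousOn ⟨hyc.le, hxc.le⟩
      have := hfar z hz
      rw [show dist O z = dist O c from hzc, sub_self, abs_zero] at this
      linarith
    rcases hside with h | h
    · left
      have h1 := hfar q₀ hq₀.1
      rw [abs_of_nonpos (by linarith [h q₀ hq₀.1])] at h1
      linarith [neg_abs_le (dist O q - dist O c)]
    · right
      intro x hx
      have h1 := hfar x hx
      rw [abs_of_nonneg (by linarith [h x hx])] at h1
      linarith [le_abs_self (dist O q - dist O c)]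
  have hall : ∀ q ∈ frontier Ω.region, R - 2 * η ≤ dist O q := by
    intro q hq
    by_contra! hlt
    obtain ⟨q₁, hq₁, hval⟩ := Ω.isConnected_frontier.isPreconnected.intermediate_value hq hq₀
      hcont.continuousOn (show (dist O q + R) / 2 ∈ Set.Icc (dist O q) (dist O q₀) from
        ⟨by linarith, by linarith⟩)
    change dist O q₁ = (dist O q + R) / 2 at hval
    rcases halt q₁ hq₁ with h | h
    · linarith
    · linarith [h q hq.1]
  obtain ⟨⟨c, hc, hcΩ⟩, -⟩ := hT q₀ hq₀
  have hρ : 0 < ρ := by linarith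
  have hcmem : c ∈ Ω.region := hcΩ (Metric.mem_ball_self hρ)
  have hcR := hmax c (subset_closure hcmem)
  have hRρ : ρ ≤ 2 * R := by
    have := dist_triangle_left q₀ c O
    linarith
  refine ⟨R - 2 * η, R, by linarith, by linarith, ball_subset_of_frontier hn ?_ fun x hx => ?_,
    fun x hx => ?_, by linarith⟩
  · rcases lt_or_ge (dist O c) (R - 2 * η) with h | h
    · exact ⟨c, by rwa [Metric.mem_ball, dist_comm], hcmem⟩
    · obtain ⟨y, hy, hyc⟩ := exists_dist_eq hn O c (τ := dist O c - ρ / 4)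
        ((isRadius_dist O c).mono (by linarith) (by linarith))
      refine ⟨y, ?_, hcΩ ?_⟩
      · rw [Metric.mem_ball, dist_comm, hy]
        linarith
      · rw [Metric.mem_ball, hyc, sub_sub_cancel_left, abs_neg, abs_of_pos (by linarith)]
        linarith
  · rw [dist_comm]
    exact hall x hx
  · obtain ⟨y, hy, hlt⟩ := exists_dist_gt hn O x (fun h => hpi h x hx) Ω.isOpen hx
    rw [Metric.mem_ball, dist_comm]
    exact hlt.trans_le (hmax y (subset_closure hy))

lemma TouchingBall.mono (hn : n ≠ 0) {Ω : Domain M n} {ρ s : ℝ} (h : TouchingBall Ω ρ)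
    (hs0 : 0 ≤ s) (hs : s ≤ ρ) : TouchingBall Ω s := by
  intro p hp
  obtain ⟨⟨c, hc, hcΩ⟩, c', hc', hcΩ'⟩ := h p hp
  obtain ⟨b, hb, hbc⟩ := exists_smaller_touching_ball hn hc hs0 hs
  obtain ⟨b', hb', hbc'⟩ := exists_smaller_touching_ball hn hc' hs0 hs
  exact ⟨⟨b, hb, hbc.trans hcΩ⟩, b', hb', hcΩ'.mono_left hbc'⟩

/-- The core estimate: if the domain is `ε`-close to its reflections about all critical
hyperplanes, then it is almost invariant under all rotations around its centre of mass. -/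
lemma exists_almost_symmetric (hn : n ≠ 0) {Ω : Domain M n} {r A L ε : ℝ} (hr0 : 0 < r)
    (hr : r ≤ 1) (hT : TouchingBall Ω r) (hA : 0 ≤ A) (hΩA : Ω.area ≤ ENNReal.ofReal A)
    (hL : ∀ x ∈ closure Ω.region, ∀ y ∈ closure Ω.region, dist x y ≤ L) (hε0 : 0 < ε)
    (hε : ε ≤ 1 / 380) (hεr : ε ≤ r)
    (hcrit : ∀ v, ∀ x ∈ Ω.region,
      Metric.infDist (reflect M v (criticalValue Ω.region v) x) Ω.region ≤ ε) :
    ∃ O ∈ plus M n, ∀ x ∈ Ω.region, ∀ y, dist O y = dist O x → Metric.infDist y Ω.region ≤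
      ε + 4 * Real.cosh L * (Real.cosh (L + 1) * (A * 570 ^ n * 15 ^ (n - 1) * unitBallVolume n /
        unitBallVolume (n - 1) * ε) / centerWeight n r) := by
  have hω := unitBallVolume_pos n
  have hω' := unitBallVolume_pos (n - 1)
  obtain ⟨q, hq⟩ := Ω.isConnected_frontier.nonempty
  obtain ⟨⟨c, -, hcΩ⟩, -⟩ := hT q hq
  obtain ⟨O, hO, β, hβ, hmean, hEH, hS⟩ := exists_center hn Ω hr0 hr hcΩ fun x hx y hy =>
    hL x (subset_closure hx) y (subset_closure hy)
  refine ⟨O, hO, fun x hx y hxy => ?_⟩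
  set W := A * 570 ^ n * 15 ^ (n - 1) * unitBallVolume n / unitBallVolume (n - 1) * ε with hW
  have hW0 : 0 ≤ W := by positivity
  have hw := centerWeight_pos (n := n) hr0 hr
  by_cases hne : x = y
  · rw [← hne, Metric.infDist_zero_of_mem hx]
    have := Real.cosh_pos L
    have := Real.cosh_pos (L + 1)
    positivity
  obtain ⟨v, s, a, w, hsp, hs, rfl⟩ := exists_reflect_eq hO hne hxy.symm
  set m := criticalValue Ω.region v with hm
  have hheight : ∀ z ∈ Ω.region, |height v m z| ≤ Real.cosh (L + 1) := by
    intro z hz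
    refine abs_height_le v m z ?_
    obtain ⟨z', hz', hd⟩ := Ω.isCompact_closure.exists_infDist_eq_dist
      Ω.isConnected.nonempty.closure (reflect M v m z)
    rw [Metric.infDist_closure] at hd
    have h1 := hcrit v z hz
    have h2 := hL z (subset_closure hz) z' hz'
    have h3 := dist_triangle_right z (reflect M v m z) z'
    linarith
  have he : β * |height v m O| ≤ Real.cosh (L + 1) * W := by
    rw [← abs_of_pos hβ, ← abs_mul, ← hmean]
    exact abs_integral_height_le hn Ω v m (Real.cosh_pos _).le hW0 hheight
      (measure_not_reflect_le hn hT hA hΩA hε0 hε hεr (hcrit v))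
  have hmove := dist_reflect_reflect_le hsp hs (Ω.closure_subset (subset_closure hx)) m hβ hw
    (fun h => ⟨(hEH h).1, (hEH h).2 x hx⟩) hS he
  have h1 := Metric.infDist_le_infDist_add_dist (s := Ω.region) (x := reflect M v s x)
    (y := reflect M v m x)
  have h2 := hcrit v x hx
  linarith

end SpaceForm

theorem theorem6p3 (n : ℕ) (hn : 2 ≤ n) (ρ A K : ℝ) (hρ : 0 < ρ) (hA : 0 < A) (hK : 0 < K) :
    ∃ C : ℝ, 0 < C ∧
      ∀ (M : SpaceForm) (deficit : SpaceForm.DeficitFunction M n) (Ω : SpaceForm.Domain M n),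
        SpaceForm.TouchingBall Ω ρ →
        Ω.area ≤ ENNReal.ofReal A →
        SpaceForm.ApproxSymmetric deficit Ω K →
        deficit.toFun Ω ≤ Ω.volume.toReal / (4 * K) →
        ∃ O ∈ SpaceForm.plus M n, ∃ r R : ℝ, 0 < r ∧ r ≤ R ∧
          Metric.ball O r ⊆ Ω.region ∧ Ω.region ⊆ Metric.ball O R ∧
          R - r ≤ C * deficit.toFun Ω := by
  have hn0 : n ≠ 0 := by omega
  obtain ⟨L, hL0, hL⟩ := SpaceForm.exists_dist_le hn0 hρ hA
  set r := min ρ 1 with hr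
  have hr0 : 0 < r := lt_min hρ one_pos
  have hr1 : r ≤ 1 := min_le_right _ _
  set D := 1 + 4 * Real.cosh L * (Real.cosh (L + 1) * (A * 570 ^ n * 15 ^ (n - 1) *
    SpaceForm.unitBallVolume n / SpaceForm.unitBallVolume (n - 1)) /
      SpaceForm.centerWeight n r) with hD
  have hD1 : 1 ≤ D := by
    have h1 := SpaceForm.unitBallVolume_pos n
    have h2 := SpaceForm.unitBallVolume_pos (n - 1)
    have h3 := SpaceForm.centerWeight_pos (n := n) hr0 hr1
    have h4 := Real.cosh_pos L
    have h5 := Real.cosh_pos (L + 1)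
    have h6 : 0 ≤ 4 * Real.cosh L * (Real.cosh (L + 1) * (A * 570 ^ n * 15 ^ (n - 1) *
      SpaceForm.unitBallVolume n / SpaceForm.unitBallVolume (n - 1)) /
        SpaceForm.centerWeight n r) := by positivity
    linarith
  -- below this threshold the symmetry argument applies, above it the diameter bound suffices
  set ε₀ := r / (380 * D) with hε₀
  have hε₀0 : 0 < ε₀ := by positivity
  refine ⟨2 * D * K + (L + 1) / ε₀ * K, by positivity, ?_⟩
  intro M deficit Ω hT hΩA hasp _
  have hδ0 := deficit.nonneg Ω
  set δ := deficit.toFun Ω with hδ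
  rcases hδ0.eq_or_lt with h0 | hδpos
  · obtain ⟨O, R, hR, hball⟩ := (deficit.eq_zero_iff Ω).1 h0.symm
    refine ⟨O, Ω.closure_subset (subset_closure (hball ▸ Metric.mem_ball_self hR)), R, R, hR,
      le_rfl, hball.ge, hball.le, ?_⟩
    rw [← h0, sub_self, mul_zero]
  have hTr := hT.mono hn0 hr0.le (min_le_left ρ 1)
  rcases le_or_gt (K * δ) ε₀ with hsmall | hlarge
  · have hDε : D * (K * δ) ≤ r / 380 := by
      calc D * (K * δ) ≤ D * ε₀ := by gcongr
        _ = r / 380 := by rw [hε₀]; field_simp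
    have hKδ : 0 < K * δ := mul_pos hK hδpos
    have hKD : K * δ ≤ D * (K * δ) := le_mul_of_one_le_left hKδ.le hD1
    obtain ⟨O, hO, hsym⟩ := SpaceForm.exists_almost_symmetric hn0 hr0 hr1 hTr hA.le hΩA
      (hL M Ω hT hΩA) hKδ (by linarith) (by linarith)
      fun v x hx => hasp.infDist_reflect_le v hx
    obtain ⟨r', R, hr', hrR, hin, hout, hle⟩ :=
      SpaceForm.exists_balls_of_almost_symmetric hn0 hO hTr (η := D * (K * δ)) (by positivity)
        (by linarith) fun x hx y hy => (hsym x hx y hy).trans (le_of_eq (by rw [hD]; ring))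
    refine ⟨O, hO, r', R, hr', hrR, hin, hout, hle.trans ?_⟩
    have : 0 ≤ (L + 1) / ε₀ * K * δ := by positivity
    linarith
  · obtain ⟨q, hq⟩ := Ω.isConnected_frontier.nonempty
    obtain ⟨⟨c, -, hcΩ⟩, -⟩ := hTr q hq
    have hc : c ∈ closure Ω.region := subset_closure (hcΩ (Metric.mem_ball_self hr0))
    refine ⟨c, Ω.closure_subset hc, r, L + 1, hr0, by linarith, hcΩ, fun x hx => ?_, ?_⟩
    · rw [Metric.mem_ball]
      linarith [hL M Ω hT hΩA x (subset_closure hx) c hc]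
    · have h1 : L + 1 ≤ (L + 1) / ε₀ * (K * δ) := by
        rw [div_mul_eq_mul_div, le_div_iff₀ hε₀0]
        gcongr
      have h2 : 0 ≤ 2 * D * K * δ := by positivity
      linarith
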